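/- **Setting.** Let $d=2$, $\alpha=1$. For an odd integer $L\ge 3$ and $n\in\mathbb N=\{0,1,2,\dots\}$ let $\Lambda^n=\{x\in\mathbb Z^2:|x_i|<L^n/2\}$ and $\Lambda_{-n}=L^{-n}\Lambda^n\subset\mathbb T^2=[-\tfrac12,\tfrac12)^2$. For $0\le k\le n$ the lattice $\Lambda^n$ is partitioned into the blocks of side length $L^k$ centred at the points of $L^k\Lambda^{n-k}$. $Q_k$ averages a function on $\Lambda^n$ over these blocks (giving a function constant on blocks), $P_k=Q_{k-1}-Q_k$, and $S_{m-n}Q_{m-n}:\mathcal C(\Lambda^m)\to\mathcal C(\Lambda^n)$, $n\le m$, maps $f$ to the function whose value at $x$ is the average of $f$ over the block of side length $L^{m-n}$ centred at $L^{m-n}x$. Put $-\Delta_H=\sum_{k=1}^nL^{-2(k-1)}P_k$ on $\mathcal C(\Lambda^n)$ and $-\underline\Delta_{H,-N}=L^{2N}S_N(-\Delta_H)S_{-N}$ on $\mathcal C(\Lambda_{-N})$, where $S_kf=f(L^k\,\cdot)$; and $\Gamma_k=\sum_{j=1}^kL^{2(j-1)}P_j$. Let $\xi$ be a white noise on $\mathbb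 T^2$ (a centred Gaussian process indexed by $L^2(\mathbb T^2)$ with covariance the $L^2$ inner product) on a probability space $(\Omega,\mathcal F,\mathbf P)$. Let $\underline\xi_n(z)=L^{2n}\xi(\mathbf 1_{\square_{-n}(z)})$, $z\in\Lambda_{-n}$, where $\square_{-n}(z)$ is the (half-open) square of side $L^{-n}$ centred at $z$, and $\xi_{-n}(x)=L^{-n}\underline\xi_n(L^{-n}x)$, $x\in\Lambda^n$. With $X\diamond Y=XY-\mathbf E[XY]$, set $\Xi^{(N)}_{-n}=S_{N-n}Q_{N-n}(\xi_{-N}\diamond\Gamma_{N-n}\xi_{-N})$ for $n\le N$ and $\Xi^{(N)}_{-n}=0$ for $n>N$; let $\xi^{(N)}_{-n}=\xi_{-n}$ for $n\le N$ and $0$ for $n>N$. For $\kappa_s>0$ and $g\in(0,1]$ let $$\Omega_g=\Big\{\sup_{N}\sup_{n}L^{-\kappa_sn}\Big(\sup_{x\in\Lambda^n}|\xi^{(N)}_{-n}(x)|\vee\sup_{x\in\Lambda^n}|\Xi^{(N)}_{-n}(x)|^{1/2}\Big)\le(2g)^{-1}\Big\}.$$ For $r\ge1$ write $\lambda_{-n}=L^{-n}g$,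 $\gamma_{-n}=L^{-n}$, $\mu_{-n}=L^{-2n}\big(r-n(1-L^{-2})g^2\big)$. Consider the bare equation on $\Lambda_{-N}$ $$-\underline\Delta_{H,-N}u_N=\big(g\,\underline\xi_N+r-(1-L^{-2})Ng^2\big)u_N+1 ,\tag{1}$$ and, given a solution, put $v_{-N}(x)=L^Nu_N(L^{-N}x)$ and $v^{(N)}_{-n}=L^{-(N-n)}S_{N-n}Q_{N-n}v_{-N}$ for $0\le n\le N$. Consider the remainder flow: $\Psi^{(N)}_{-n}=0$ for $n\ge N$ and, for $n=N,\dots,1$ (superscripts $(N)$ omitted), the function $R_{-n+1}$ on $\Lambda^n$ solves $$\begin{aligned}R_{-n+1}={}&P_1\Xi_{-n}+P_1(\xi_{-n}P_1\xi_{-n})+\lambda_{-n}P_1\Psi_{-n}+\lambda_{-n}P_1(\xi_{-n}R_{-n+1})+\lambda_{-n}P_1(\Xi_{-n}P_1\xi_{-n})\\&+\lambda_{-n}^2P_1(\Xi_{-n}R_{-n+1})+\lambda_{-n}^2P_1(\Psi_{-n}P_1\xi_{-n})+\lambda_{-n}^3P_1(\Psi_{-n}R_{-n+1})\\&+\mu_{-n}\lambda_{-n}^{-1}P_1\xi_{-n}+\mu_{-n}R_{-n+1},\end{aligned}\tag{2}$$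 $$\begin{aligned}\Psi_{-n+1}=L^{-1}S_1Q_1\big(&\Psi_{-n}+\xi_{-n}R_{-n+1}+\Xi_{-n}P_1\xi_{-n}+\lambda_{-n}\Xi_{-n}R_{-n+1}\\&+\lambda_{-n}\Psi_{-n}P_1\xi_{-n}+\lambda_{-n}^2\Psi_{-n}R_{-n+1}\big).\end{aligned}\tag{3}$$ **Proposition.** There is $\kappa_0>0$ such that for every $r\ge1$ there is $L_0$, depending only on $r$, such that for every odd $L\ge L_0$, every $\kappa_s\in(0,\kappa_0]$ and every $g\in(0,1]$ the following holds for $\mathbf P$-almost every $\omega\in\Omega_g$. For every $N\in\mathbb N$, equation (1) has a unique solution $u_N$, and the flow (2)–(3) has a unique solution $\big(\Psi^{(N)}_{-n},R^{(N)}_{-n+1}\big)$. For every $n\in\mathbb N$ the limits $$v^\star_{-n}=\lim_{N\to\infty}v^{(N)}_{-n},\qquad \Xi^\star_{-n}=\lim_{N\to\infty}\Xi^{(N)}_{-n},\qquad \Psi^\star_{-n}=\lim_{N\to\infty}\Psi^{(N)}_{-n}$$ exist in $\mathcal C(\Lambda^n)$, and on $\Lambda^n$ $$(-\Delta_H)v^\star_{-n}=\big(\lambda_{-n}\xi_{-n}+\lambda_{-n}^2\Xi^\star_{-n}+\lambda_{-n}^3\Psi^\star_{-n}+\mu_{-n}\big)v^\star_{-n}+\gamma_{-n}.$$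 Moreover $v^\star_{-n}=L^{-(m-n)}S_{m-n}Q_{m-n}v^\star_{-m}$ for all $m>n$. -/

import Mathlib

open MeasureTheory ProbabilityTheory Filter Topology
open scoped ENNReal

noncomputable section

/-! The dimension is `d = 2`, so that `α = 2 - d / 2 = 1`; all powers below are written with these
values.  `L` is the (odd) coarse graining scale.

The lattice of spacing `L ^ m` and side length `L ^ M`, centred at the origin, consists of the points
`L ^ m • z`, where `z` runs over the unit lattice of side length `L ^ (M - m)`.  A function on it is
represented by the function of `z`, so that the rescaling `S_k` only changes the lattice on which a
function is read. -/

/-- The unit lattice `Λ^n`: the points of `ℤ²` in the square of side length `L ^ n` centred at `0`. -/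
abbrev UnitLat (L n : ℕ) : Type :=
  {x : Fin 2 → ℤ // ∀ i, 2 * |x i| < (L : ℤ) ^ n}

instance UnitLat.instFinite (L n : ℕ) : Finite (UnitLat L n) := by
  refine Set.Finite.to_subtype (s := {x : Fin 2 → ℤ | ∀ i, 2 * |x i| < (L : ℤ) ^ n}) ?_
  refine Set.Finite.subset
    (Set.finite_Icc (fun _ : Fin 2 => -((L : ℤ) ^ n)) (fun _ : Fin 2 => (L : ℤ) ^ n)) ?_
  intro x hx
  refine ⟨fun i => ?_, fun i => ?_⟩
  · have h := hx i
    have h1 := neg_abs_le (x i)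
    have h2 := abs_nonneg (x i)
    dsimp only
    linarith
  · have h := hx i
    have h1 := le_abs_self (x i)
    have h2 := abs_nonneg (x i)
    dsimp only
    linarith

instance UnitLat.instFintype (L n : ℕ) : Fintype (UnitLat L n) := Fintype.ofFinite _

/-- Families of functions, one on each unit lattice `Λ^n`; the index `n` stands for the scale
`L ^ (-n)` on the torus. -/
abbrev Traj (L : ℕ) : Type := (n : ℕ) → UnitLat L n → ℝ

/-- `y` lies in the square of side length `L ^ k` centred at `L ^ k • c`. -/
def InBlock (L k : ℕ) (c y : Fin 2 → ℤ) : Prop :=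
  ∀ i, 2 * |y i - (L : ℤ) ^ k * c i| < (L : ℤ) ^ k

open Classical in
/-- `S_{m-n} Q_{m-n} : C(Λ^m) → C(Λ^n)` for `n ≤ m`: the value at `x` is the average over the square of
side length `L ^ (m - n)` centred at `L ^ (m - n) • x`. -/
def coarse (L m n : ℕ) (f : UnitLat L m → ℝ) (x : UnitLat L n) : ℝ :=
  ((L : ℝ) ^ (2 * (m - n)))⁻¹ *
    ∑ y ∈ Finset.univ.filter (fun y : UnitLat L m => InBlock L (m - n) x.1 y.1), f y

open Classical in
/-- The averaging operator `Q_k` on `C(Λ^n)` for `k ≤ n`, with values in the functions on `Λ^n` that are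
constant on the squares of side length `L ^ k`: the value at `x` is the average over the square that
contains `x`. -/
def blockAvg (L n k : ℕ) (f : UnitLat L n → ℝ) (x : UnitLat L n) : ℝ :=
  ((L : ℝ) ^ (2 * k))⁻¹ *
    ∑ y ∈ Finset.univ.filter
      (fun y : UnitLat L n => ∃ c : Fin 2 → ℤ, InBlock L k c x.1 ∧ InBlock L k c y.1), f y

/-- The fluctuation operator `P_k = Q_{k-1} - Q_k` on `C(Λ^n)`, for `1 ≤ k ≤ n`. -/
def fluct (L n k : ℕ) (f : UnitLat L n → ℝ) (x : UnitLat L n) : ℝ :=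
  blockAvg L n (k - 1) f x - blockAvg L n k f x

/-- `-Δ_H = ∑_{k=1}^n L^{-2(k-1)} P_k` on the unit lattice `Λ^n`. -/
def negLap (L n : ℕ) (f : UnitLat L n → ℝ) (x : UnitLat L n) : ℝ :=
  ∑ k ∈ Finset.Icc 1 n, ((L : ℝ) ^ (2 * (k - 1)))⁻¹ * fluct L n k f x

/-- The hierarchical Laplacian `-Δ_{H,-N} = ∑_{n=1}^N L^{2n} P_{-n}`, `P_{-n} = Q_{-n} - Q_{-n+1}`, on the
lattice `Λ_{-N}` of spacing `L ^ (-N)` in the torus.  `Q_{-n}` averages over the squares of side length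
`L ^ (-n)`, that is `L ^ (N - n)` lattice spacings.  `f z` is the value at the point `L ^ (-N) • z`. -/
def negLapTorus (L N : ℕ) (f : UnitLat L N → ℝ) (z : UnitLat L N) : ℝ :=
  ∑ n ∈ Finset.Icc 1 N,
    (L : ℝ) ^ (2 * n) * (blockAvg L N (N - n) f z - blockAvg L N (N - n + 1) f z)

/-- The fluctuation propagator `Γ_k = ∑_{j=1}^k L^{2(j-1)} P_j` on `C(Λ^n)`. -/
def fluctProp (L n k : ℕ) (f : UnitLat L n → ℝ) (x : UnitLat L n) : ℝ :=
  ∑ j ∈ Finset.Icc 1 k, (L : ℝ) ^ (2 * (j - 1)) * fluct L n j f x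

/-! ### White noise on the torus -/

/-- Lebesgue measure on `[-1/2, 1/2)²`. -/
def torusMeasure : Measure (Fin 2 → ℝ) :=
  volume.restrict (Set.pi Set.univ fun _ => Set.Ico (-1 / 2 : ℝ) (1 / 2))

instance torusMeasure.instIsFiniteMeasure : IsFiniteMeasure torusMeasure := by
  constructor
  rw [torusMeasure, Measure.restrict_apply_univ, volume_pi_pi]
  exact ENNReal.prod_lt_top fun i _ => by simp [Real.volume_Ico]

/-- White noise on the torus: a centred Gaussian process indexed by `L²` of the torus whose covariance
is the `L²` inner product. -/
structure IsWhiteNoise {Ω : Type*} [MeasurableSpace Ω] (P : Measure Ω)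
    (W : Lp ℝ 2 torusMeasure → Ω → ℝ) : Prop where
  gaussian : IsGaussianProcess W P
  mean : ∀ f, ∫ ω, W f ω ∂P = 0
  cov : ∀ f h, ∫ ω, W f ω * W h ω ∂P = inner ℝ f h

/-- The square of side length `L ^ (-n)` centred at the point `L ^ (-n) • z`. -/
def cell (L n : ℕ) (z : UnitLat L n) : Set (Fin 2 → ℝ) :=
  Set.pi Set.univ fun i =>
    Set.Ico (((z.1 i : ℝ) - 1 / 2) / (L : ℝ) ^ n) (((z.1 i : ℝ) + 1 / 2) / (L : ℝ) ^ n)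

theorem measurableSet_cell (L n : ℕ) (z : UnitLat L n) : MeasurableSet (cell L n z) :=
  MeasurableSet.univ_pi fun _ => measurableSet_Ico

section Noise

variable {Ω : Type*}

/-- The average `Q_{-n} ξ` of the white noise over the squares of side length `L ^ (-n)`, a function on
the lattice `Λ_{-n}`; `z` stands for the point `L ^ (-n) • z`. -/
def torusNoise (L : ℕ) (W : Lp ℝ 2 torusMeasure → Ω → ℝ) (n : ℕ) (z : UnitLat L n) (ω : Ω) : ℝ :=
  (L : ℝ) ^ (2 * n) *
    W (indicatorConstLp 2 (measurableSet_cell L n z) (measure_ne_top torusMeasure _) (1 : ℝ)) ω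

/-- The noise `ξ_{-n}` on the unit lattice `Λ^n`. -/
def unitNoise (L : ℕ) (W : Lp ℝ 2 torusMeasure → Ω → ℝ) (n : ℕ) (x : UnitLat L n) (ω : Ω) : ℝ :=
  ((L : ℝ) ^ n)⁻¹ * torusNoise L W n x ω

/-- The noise truncated at scale `L ^ (-N)`. -/
def truncNoise (L : ℕ) (W : Lp ℝ 2 torusMeasure → Ω → ℝ) (N n : ℕ) (x : UnitLat L n) (ω : Ω) : ℝ :=
  if n ≤ N then unitNoise L W n x ω else 0

variable [MeasurableSpace Ω]

/-- The Wick product `X ⋄ Y = X Y - E[X Y]` (of two linear functionals of the noise). -/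
def wick (P : Measure Ω) (X Y : Ω → ℝ) (ω : Ω) : ℝ :=
  X ω * Y ω - ∫ ω', X ω' * Y ω' ∂P

/-- The second chaos `Ξ^{(N)}_{-n} = S_{N-n} Q_{N-n} (ξ_{-N} ⋄ Γ_{N-n} ξ_{-N})` for `n ≤ N`, and `0` for
`n > N`.  (The prefactor `L^{(2-2α)(N-n)}` is `1`.) -/
def secondChaos (P : Measure Ω) (L : ℕ) (W : Lp ℝ 2 torusMeasure → Ω → ℝ) (N n : ℕ) (x : UnitLat L n)
    (ω : Ω) : ℝ :=
  if n ≤ N then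
    coarse L N n
      (fun y => wick P (unitNoise L W N y)
        (fun ω' => fluctProp L N (N - n) (fun z => unitNoise L W N z ω') y) ω) x
  else 0

/-- `sup_N sup_n L^{-κ n} (sup_x |ξ^{(N)}_{-n}(x)| ∨ sup_x |Ξ^{(N)}_{-n}(x)|^{1/2})`, in `[0, ∞]`. -/
def enhancedNorm (P : Measure Ω) (L : ℕ) (κ : ℝ) (W : Lp ℝ 2 torusMeasure → Ω → ℝ) (ω : Ω) : ℝ≥0∞ :=
  ⨆ N : ℕ, ⨆ n : ℕ, ENNReal.ofReal ((L : ℝ) ^ (-κ * n)) *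
    max (⨆ x : UnitLat L n, ENNReal.ofReal |truncNoise L W N n x ω|)
      (⨆ x : UnitLat L n, ENNReal.ofReal (Real.sqrt |secondChaos P L W N n x ω|))

/-- The event `Ω_g`. -/
def goodEvent (P : Measure Ω) (L : ℕ) (κ : ℝ) (W : Lp ℝ 2 torusMeasure → Ω → ℝ) (g : ℝ) : Set Ω :=
  {ω | enhancedNorm P L κ W ω ≤ ENNReal.ofReal (2 * g)⁻¹}

end Noise

/-! ### The bare equation and the coarse grained solutions -/

/-- `λ_{-n} = L^{-n} g`. -/
def lamC (L : ℕ) (g : ℝ) (n : ℕ) : ℝ := ((L : ℝ) ^ n)⁻¹ * g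

/-- `γ_{-n} = L^{-n}`. -/
def gamC (L : ℕ) (n : ℕ) : ℝ := ((L : ℝ) ^ n)⁻¹

/-- `μ_{-n} = L^{-2n} (r - n (1 - L^{-2}) g²)`. -/
def muC (L : ℕ) (r g : ℝ) (n : ℕ) : ℝ :=
  ((L : ℝ) ^ (2 * n))⁻¹ * (r - n * (1 - ((L : ℝ) ^ 2)⁻¹) * g ^ 2)

/-- `u` solves `-Δ_{H,-N} u = (g ξ + r_N) u + 1` on `Λ_{-N}`, with the bare mass
`r_N = r - (1 - L^{-2}) N g²` and a given noise `ξ`. -/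
def IsBareSolution (L : ℕ) (r g : ℝ) (N : ℕ) (ξ u : UnitLat L N → ℝ) : Prop :=
  ∀ z, negLapTorus L N u z = (g * ξ z + (r - (1 - ((L : ℝ) ^ 2)⁻¹) * N * g ^ 2)) * u z + 1

/-- `v_{-N} = L^N S_{-N} u_N` on the unit lattice `Λ^N`. -/
def unitSol (L N : ℕ) (u : UnitLat L N → ℝ) (x : UnitLat L N) : ℝ := (L : ℝ) ^ N * u x

/-- `v^{(N)}_{-n} = L^{-(N-n)} S_{N-n} Q_{N-n} v_{-N}` on `Λ^n`, for `n ≤ N`. -/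
def coarseSol (L N n : ℕ) (u : UnitLat L N → ℝ) (x : UnitLat L n) : ℝ :=
  ((L : ℝ) ^ (N - n))⁻¹ * coarse L N n (unitSol L N u) x

/-! ### The remainder of the effective force -/

/-- The flow of the remainder `Ψ^{(N)}` for given noise `ξ` and second chaos `Ξ` (at a fixed realisation).
It starts from `Ψ_{-N} = 0`; for `1 ≤ n ≤ N` the fluctuation remainder `R n`, a function on `Λ^n`
(it is the object with index `-n+1`), solves a linear fixed point problem driven by `ξ, Ξ, Ψ` at
scale `n`, and `Ψ_{-n+1}` is then computed from it.  `Ψ n` and `R n` are set to `0` where the flow does not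
define them. -/
structure IsRemainderFlow (L : ℕ) (r g : ℝ) (N : ℕ) (ξ Ξ Ψ R : Traj L) : Prop where
  psi_zero : ∀ n, N ≤ n → Ψ n = 0
  rem_zero : ∀ n, n = 0 ∨ N < n → R n = 0
  rem_eq : ∀ n, 1 ≤ n → n ≤ N → ∀ x,
    R n x =
      fluct L n 1 (Ξ n) x
      + fluct L n 1 (ξ n * fluct L n 1 (ξ n)) x
      + lamC L g n * fluct L n 1 (Ψ n) x
      + lamC L g n * fluct L n 1 (ξ n * R n) x
      + lamC L g n * fluct L n 1 (Ξ n * fluct L n 1 (ξ n)) x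
      + lamC L g n ^ 2 * fluct L n 1 (Ξ n * R n) x
      + lamC L g n ^ 2 * fluct L n 1 (Ψ n * fluct L n 1 (ξ n)) x
      + lamC L g n ^ 3 * fluct L n 1 (Ψ n * R n) x
      + muC L r g n * (lamC L g n)⁻¹ * fluct L n 1 (ξ n) x
      + muC L r g n * R n x
  psi_eq : ∀ n, n + 1 ≤ N → ∀ x,
    Ψ n x = (L : ℝ)⁻¹ *
      (coarse L (n + 1) n (Ψ (n + 1)) x
      + coarse L (n + 1) n (ξ (n + 1) * R (n + 1)) x
      + coarse L (n + 1) n (Ξ (n + 1) * fluct L (n + 1) 1 (ξ (n + 1))) x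
      + lamC L g (n + 1) * coarse L (n + 1) n (Ξ (n + 1) * R (n + 1)) x
      + lamC L g (n + 1) * coarse L (n + 1) n (Ψ (n + 1) * fluct L (n + 1) 1 (ξ (n + 1))) x
      + lamC L g (n + 1) ^ 2 * coarse L (n + 1) n (Ψ (n + 1) * R (n + 1)) x)

end

/-! The theorem holds because the equation `-Δ_H v = F v + γ` on `Λ^(n+1)` can be solved in two steps:
first for the fluctuation `P_1 v`, given the block averages, and then for the block averages. The
first step gives `v = w · Q_1 v`, where the factor `w` solves `w = 1 + P_1 (F w)` (`IsFactor`), a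
contraction when `F` is small. Since `-Δ_H` on `Λ^(n+1)` is `P_1` plus `L⁻²` times the hierarchical
Laplacian of the block averages (`negLap_succ`), what remains is the same equation on `Λ^n`, with `F`
replaced by `L² Q_1 (F w)` (`IsFactor.negLap_mul_lift_iff`). On the single point of `Λ^0` the equation
is `F v + 1 = 0`. So unique solvability is a matter of following the force `F` down the scales
(`IsForceFlow`).

The force that starts from `λ ξ + μ` on `Λ^N` has the form `λ ξ + λ² Ξ + λ³ Ψ + μ`: the first and
second order terms reproduce themselves by the scale consistency of `ξ` and `Ξ`, with the mass
counterterm in the role of the expectation in the Wick product, and the flow of `(Ψ, R)` is a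
rewriting of the recursion for `F`, with `w = 1 + λ P_1 ξ + λ² R` (`rem_eq_iff_isFactor`,
`psi_eq_iff_step`). On the good event `λ ξ` is at most `s^n / 2` with `s = L^(-5/6)`, and the remainder
`λ³ Ψ` is of order `L² s³ s^(3n)`, because each step multiplies it by about `L²` and `L² s³ = L^(-1/2)`
is small (`IsSmall.norm_forceRem_le`). In particular `F ≥ 5 / 48` on `Λ^0`, since `r ≥ 1`. The same
power counting shows that the forces form a Cauchy sequence as `N → ∞`: two of them differ at a fine
scale `n + k` by the difference of the second chaoses plus remainders of order `s^(3(n+k))`, and `k`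
steps multiply differences by at most `(2 L²)^k` (`IsSmall.cauchySeq_force`). The solutions are
explicit products of factors and converge with them.

Probability enters in two places. Almost surely the noise on a cell is the sum of the noise on its
subcells (`unitNoise_ae_eq`). And almost surely the second chaos converges: it is a sum over scales
`i` of differences of the centred averages `Q (ξ_{-i}²) - 1` (`secondChaos_eq`), each of which is an
average of `L^(2(i-n))` independent variables of bounded variance, so its `L²` norm is of order
`L^(-(i-n))` and the sum converges absolutely (`ae_summable_sqAvg_sub_one`). -/

noncomputable section

/-! ### Blocks and averages on the hierarchical lattice -/

section Blocks

variable {L : ℕ}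

theorem inBlock_iff (hL : Odd L) (k : ℕ) (c y : Fin 2 → ℤ) :
    InBlock L k c y ↔ ∀ i, (2 * y i + (L : ℤ) ^ k) / (2 * (L : ℤ) ^ k) = c i := by
  obtain ⟨j, hj⟩ : Odd ((L : ℤ) ^ k) := by exact_mod_cast hL.pow
  have hpos : 0 < (L : ℤ) ^ k := pow_pos (by exact_mod_cast hL.pos) k
  refine forall_congr' fun i => ?_
  generalize hK : (L : ℤ) ^ k = K at *
  have h2K : 0 < 2 * K := by linarith
  constructor
  · intro h
    have h1 := abs_lt.1 (show |2 * (y i - K * c i)| < K by rw [abs_mul]; simpa using h)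
    refine le_antisymm ?_ ?_
    · exact Int.lt_add_one_iff.1 (Int.ediv_lt_of_lt_mul h2K (by nlinarith))
    · exact Int.le_ediv_of_mul_le h2K (by nlinarith)
  · intro h
    have h1 := Int.ediv_mul_le (2 * y i + K) (ne_of_gt h2K)
    have h2 := Int.lt_ediv_add_one_mul_self (2 * y i + K) h2K
    rw [h] at h1 h2
    have h3 : |2 * (y i - K * c i)| < K := by
      -- Equality is impossible on the left because `K` is odd.
      have hne : 2 * (y i - K * c i) ≠ -K := by omega
      refine abs_lt.2 ⟨lt_of_le_of_ne (by nlinarith) (Ne.symm hne), by nlinarith⟩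
    rw [abs_mul] at h3
    simpa using h3

theorem coarse_add (m n : ℕ) (f g : UnitLat L m → ℝ) :
    coarse L m n (f + g) = coarse L m n f + coarse L m n g := by
  ext x
  simp [coarse, Finset.sum_add_distrib, mul_add]

theorem coarse_smul (m n : ℕ) (c : ℝ) (f : UnitLat L m → ℝ) :
    coarse L m n (c • f) = c • coarse L m n f := by
  ext x
  simp only [coarse, Pi.smul_apply, smul_eq_mul, ← Finset.mul_sum]
  ring

/-- Averaging over blocks, as a linear map. -/
def coarseLin (L m n : ℕ) : (UnitLat L m → ℝ) →ₗ[ℝ] (UnitLat L n → ℝ) where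
  toFun := coarse L m n
  map_add' := coarse_add m n
  map_smul' := coarse_smul m n

theorem coarse_sub (m n : ℕ) (f g : UnitLat L m → ℝ) :
    coarse L m n (f - g) = coarse L m n f - coarse L m n g := (coarseLin L m n).map_sub f g

theorem coarse_sum (m n : ℕ) {ι : Type*} (s : Finset ι) (f : ι → UnitLat L m → ℝ) :
    coarse L m n (∑ i ∈ s, f i) = ∑ i ∈ s, coarse L m n (f i) := map_sum (coarseLin L m n) f s

theorem continuous_coarse (m n : ℕ) : Continuous (coarse L m n) :=
  (coarseLin L m n).continuous_of_finiteDimensional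

theorem negLap_zero (f : UnitLat L 0 → ℝ) : negLap L 0 f = 0 := by
  ext x
  simp [negLap]

variable [hL : Fact (Odd L)]

theorem side_pos (L : ℕ) [hL : Fact (Odd L)] : (0 : ℝ) < L := by exact_mod_cast hL.out.pos

/-- The point of `Λ^n` at the centre of the block of side length `L ^ (m - n)` that contains
`y ∈ Λ^m`; its coordinates are those of `L ^ (n - m) • y` rounded to the nearest integer. -/
def parent {m n : ℕ} (h : n ≤ m) (y : UnitLat L m) : UnitLat L n :=
  ⟨fun i => (2 * y.1 i + (L : ℤ) ^ (m - n)) / (2 * (L : ℤ) ^ (m - n)), by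
    have hb := (inBlock_iff hL.out (m - n) _ y.1).2 fun i => rfl
    intro i
    obtain ⟨j, hj⟩ : Odd ((L : ℤ) ^ n) := by exact_mod_cast hL.out.pow
    have hpos : 0 < (L : ℤ) ^ (m - n) := pow_pos (by exact_mod_cast hL.out.pos) _
    have h1 := hb i
    have h2 : 2 * |y.1 i| < (L : ℤ) ^ (m - n) * (L : ℤ) ^ n :=
      (y.2 i).trans_eq (by rw [← pow_add, Nat.sub_add_cancel h])
    dsimp only at h1 ⊢
    clear hb
    generalize (2 * y.1 i + (L : ℤ) ^ (m - n)) / (2 * (L : ℤ) ^ (m - n)) = c at *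
    generalize (L : ℤ) ^ (m - n) = K at *
    generalize (L : ℤ) ^ n = M at *
    have h3 : K * |c| ≤ |y.1 i| + |y.1 i - K * c| := by
      have := abs_sub_abs_le_abs_sub (K * c) (y.1 i)
      rw [abs_mul, abs_of_pos hpos, abs_sub_comm] at this
      linarith
    have h4 : 2 * |c| < M + 1 := by
      refine lt_of_mul_lt_mul_left (a := K) ?_ hpos.le
      nlinarith
    omega⟩

theorem inBlock_iff_parent {m n : ℕ} (h : n ≤ m) (x : UnitLat L n) (y : UnitLat L m) :
    InBlock L (m - n) x.1 y.1 ↔ parent h y = x := by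
  rw [inBlock_iff hL.out, Subtype.ext_iff, funext_iff]
  rfl

theorem inBlock_parent {m n : ℕ} (h : n ≤ m) (y : UnitLat L m) :
    InBlock L (m - n) (parent h y).1 y.1 :=
  (inBlock_iff_parent h _ y).2 rfl

theorem parent_parent {m n p : ℕ} (h : n ≤ m) (h' : p ≤ n) (y : UnitLat L m) :
    parent h' (parent h y) = parent (h'.trans h) y := by
  symm
  rw [← inBlock_iff_parent]
  obtain ⟨k, rfl⟩ := Nat.exists_eq_add_of_le h'
  obtain ⟨j, rfl⟩ := Nat.exists_eq_add_of_le h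
  intro i
  have h1 := inBlock_parent h y i
  have h2 := inBlock_parent h' (parent h y) i
  have e1 : p + k + j - (p + k) = j := by omega
  have e2 : p + k - p = k := by omega
  have e3 : p + k + j - p = k + j := by omega
  rw [e1] at h1
  rw [e2] at h2
  have e4 : (L : ℤ) ^ (p + k + j - p) = (L : ℤ) ^ k * (L : ℤ) ^ j := by rw [e3, pow_add]
  rw [e4]
  generalize (parent h' (parent h y)).1 i = b at *
  generalize (parent h y).1 i = a at *
  generalize y.1 i = t at *
  have hpos : 0 < (L : ℤ) ^ j := pow_pos (by exact_mod_cast hL.out.pos) _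
  have hk : 2 * |a - (L : ℤ) ^ k * b| + 1 ≤ (L : ℤ) ^ k := h2
  clear e4 e3 e2 e1 h2
  generalize (L : ℤ) ^ j = J at *
  generalize (L : ℤ) ^ k = K at *
  have h3 : |t - K * J * b| ≤ |t - J * a| + J * |a - K * b| := by
    rw [← abs_of_pos hpos, ← abs_mul, abs_of_pos hpos]
    calc |t - K * J * b| = |(t - J * a) + J * (a - K * b)| := by ring_nf
      _ ≤ _ := abs_add_le _ _
  nlinarith

@[simp]
theorem parent_self {n : ℕ} (y : UnitLat L n) : parent le_rfl y = y := by
  rw [← inBlock_iff_parent]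
  intro i
  simp

/-- Functions on `Λ^n`, read as functions on `Λ^m` that are constant on blocks. -/
def lift {m n : ℕ} (h : n ≤ m) (f : UnitLat L n → ℝ) (y : UnitLat L m) : ℝ := f (parent h y)

theorem coarse_eq {m n : ℕ} (h : n ≤ m) (f : UnitLat L m → ℝ) (x : UnitLat L n) :
    coarse L m n f x =
      ((L : ℝ) ^ (2 * (m - n)))⁻¹ * ∑ y with parent h y = x, f y := by
  unfold coarse
  congr 2
  ext y
  simp [inBlock_iff_parent h]

theorem card_block {m n : ℕ} (h : n ≤ m) (x : UnitLat L n) :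
    (Finset.univ.filter fun y : UnitLat L m => parent h y = x).card = L ^ (2 * (m - n)) := by
  obtain ⟨j, hj⟩ : Odd ((L : ℤ) ^ (m - n)) := by exact_mod_cast hL.out.pow
  have hpos : 0 < (L : ℤ) ^ (m - n) := pow_pos (by exact_mod_cast hL.out.pos) _
  have key : (Finset.univ.filter fun y : UnitLat L m => parent h y = x).map
      (Function.Embedding.subtype _) =
      Fintype.piFinset fun i => Finset.Icc ((L : ℤ) ^ (m - n) * x.1 i - j)
        ((L : ℤ) ^ (m - n) * x.1 i + j) := by
    ext z
    simp only [Finset.mem_map, Finset.mem_filter, Finset.mem_univ, true_and,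
      ← inBlock_iff_parent h, Function.Embedding.coe_subtype, Subtype.exists, exists_and_right,
      exists_eq_right, Fintype.mem_piFinset, Finset.mem_Icc]
    have hz : ∀ i, ((L : ℤ) ^ (m - n) * x.1 i - j ≤ z i ∧ z i ≤ (L : ℤ) ^ (m - n) * x.1 i + j) ↔
        2 * |z i - (L : ℤ) ^ (m - n) * x.1 i| < (L : ℤ) ^ (m - n) := by
      intro i
      rw [hj]
      constructor
      · rintro ⟨h1, h2⟩
        have : |z i - (2 * j + 1) * x.1 i| ≤ j := abs_le.2 ⟨by linarith, by linarith⟩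
        omega
      · intro h1
        have := abs_le.1 (show |z i - (2 * j + 1) * x.1 i| ≤ j by omega)
        exact ⟨by linarith, by linarith⟩
    simp only [hz]
    refine ⟨fun ⟨_, h1⟩ => h1, fun h1 => ⟨fun i => ?_, h1⟩⟩
    have h2 := h1 i
    have h3 := x.2 i
    obtain ⟨p, hp⟩ : Odd ((L : ℤ) ^ n) := by exact_mod_cast hL.out.pow
    have h3' : 2 * |x.1 i| + 1 ≤ (L : ℤ) ^ n := h3
    have hm : (L : ℤ) ^ m = (L : ℤ) ^ (m - n) * (L : ℤ) ^ n := by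
      rw [← pow_add, Nat.sub_add_cancel h]
    rw [hm]
    clear hz h1 h3 hm
    generalize (L : ℤ) ^ (m - n) = K at *
    have h4 : |z i| ≤ |z i - K * x.1 i| + K * |x.1 i| := by
      rw [← abs_of_pos hpos, ← abs_mul, abs_of_pos hpos]
      calc |z i| = |(z i - K * x.1 i) + K * x.1 i| := by ring_nf
        _ ≤ _ := abs_add_le _ _
    nlinarith
  rw [← Finset.card_map, key, Fintype.card_piFinset]
  have : ∀ i : Fin 2, (Finset.Icc ((L : ℤ) ^ (m - n) * x.1 i - j)
      ((L : ℤ) ^ (m - n) * x.1 i + j)).card = L ^ (m - n) := by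
    intro i
    rw [Int.card_Icc]
    zify
    rw [Int.toNat_of_nonneg] <;> linarith
  simp only [this, Finset.prod_const, Finset.card_univ, Fintype.card_fin]
  rw [← pow_mul, mul_comm]

theorem coarse_mul_lift {m n : ℕ} (h : n ≤ m) (f : UnitLat L m → ℝ) (g : UnitLat L n → ℝ) :
    coarse L m n (f * lift h g) = coarse L m n f * g := by
  ext x
  simp only [coarse_eq h, Pi.mul_apply, lift]
  rw [mul_assoc, Finset.sum_mul]
  congr 1
  refine Finset.sum_congr rfl fun y hy => ?_
  rw [(Finset.mem_filter.1 hy).2]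

theorem coarse_one {m n : ℕ} (h : n ≤ m) : coarse L m n 1 = 1 := by
  ext x
  have := side_pos L
  simp only [coarse_eq h, Pi.one_apply, Finset.sum_const, card_block, nsmul_eq_mul, mul_one]
  push_cast
  exact inv_mul_cancel₀ (by positivity)

theorem coarse_lift {m n : ℕ} (h : n ≤ m) (g : UnitLat L n → ℝ) :
    coarse L m n (lift h g) = g := by
  simpa [coarse_one h] using coarse_mul_lift h 1 g

theorem coarse_coarse {m n p : ℕ} (h : n ≤ m) (h' : p ≤ n) (f : UnitLat L m → ℝ) :
    coarse L n p (coarse L m n f) = coarse L m p f := by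
  ext x
  rw [coarse_eq h', coarse_eq (h'.trans h)]
  simp only [coarse_eq h]
  rw [← Finset.mul_sum, ← mul_assoc, ← mul_inv, ← pow_add]
  rw [show 2 * (n - p) + 2 * (m - n) = 2 * (m - p) by omega]
  congr 1
  · rw [← Finset.sum_fiberwise_of_maps_to
      (s := Finset.univ.filter fun y => parent (h'.trans h) y = x)
      (t := Finset.univ.filter fun z => parent h' z = x) (g := parent h)]
    · refine Finset.sum_congr rfl fun z hz => Finset.sum_congr ?_ fun _ _ => rfl
      have hz' := (Finset.mem_filter.1 hz).2
      ext y
      simp only [Finset.mem_filter, Finset.mem_univ, true_and]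
      constructor
      · intro h1
        exact ⟨by rw [← parent_parent h h', h1, hz'], h1⟩
      · exact fun h1 => h1.2
    · intro y hy
      simpa [parent_parent] using hy

theorem coarse_self (n : ℕ) (f : UnitLat L n → ℝ) : coarse L n n f = f := by
  ext x
  have : (Finset.univ.filter fun y : UnitLat L n => parent le_rfl y = x) = {x} := by
    ext y; simp
  rw [coarse_eq le_rfl, this]
  simp

theorem lift_self {n : ℕ} (f : UnitLat L n → ℝ) : lift le_rfl f = f := by
  ext y
  simp [lift]

theorem norm_coarse_le {m n : ℕ} (h : n ≤ m) (f : UnitLat L m → ℝ) : ‖coarse L m n f‖ ≤ ‖f‖ := by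
  have hp := side_pos L
  refine (pi_norm_le_iff_of_nonneg (norm_nonneg _)).2 fun x => ?_
  rw [coarse_eq h, norm_mul, norm_inv, norm_pow, Real.norm_natCast, inv_mul_le_iff₀ (by positivity)]
  refine (norm_sum_le_of_le _ fun y _ => norm_le_pi_norm f y).trans ?_
  rw [Finset.sum_const, card_block, nsmul_eq_mul]
  push_cast
  rfl

theorem norm_lift_le {m n : ℕ} (h : n ≤ m) (f : UnitLat L n → ℝ) : ‖lift h f‖ ≤ ‖f‖ :=
  (pi_norm_le_iff_of_nonneg (norm_nonneg _)).2 fun _ => norm_le_pi_norm f _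

theorem blockAvg_eq {n j k : ℕ} (hk : j + k = n) (f : UnitLat L n → ℝ) :
    blockAvg L n k f = lift (hk ▸ Nat.le_add_right j k) (coarse L n j f) := by
  have hj : j ≤ n := by omega
  ext x
  rw [blockAvg, lift, coarse_eq hj]
  have e : n - j = k := by omega
  rw [e]
  congr 2
  ext y
  simp only [Finset.mem_filter, Finset.mem_univ, true_and]
  subst e
  constructor
  · rintro ⟨c, h1, h2⟩
    rw [inBlock_iff hL.out] at h1 h2
    ext i
    exact (h2 i).trans (h1 i).symm
  · intro h1
    exact ⟨(parent hj x).1, inBlock_parent hj x, h1 ▸ inBlock_parent hj y⟩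

theorem fluct_eq {n i j k : ℕ} (hj : j + (k - 1) = n) (hi : i + k = n) (f : UnitLat L n → ℝ) :
    fluct L n k f = lift (hj ▸ Nat.le_add_right j _) (coarse L n j f)
      - lift (hi ▸ Nat.le_add_right i k) (coarse L n i f) := by
  ext x
  rw [fluct, blockAvg_eq hj, blockAvg_eq hi]
  rfl

theorem fluct_one (n : ℕ) (f : UnitLat L (n + 1) → ℝ) :
    fluct L (n + 1) 1 f = f - lift n.le_succ (coarse L (n + 1) n f) := by
  rw [fluct_eq (n := n + 1) (i := n) (j := n + 1) (k := 1) rfl rfl, coarse_self, lift_self]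

/-- The hierarchical Laplacian splits into the finest fluctuation and the Laplacian of the block
averages. -/
theorem negLap_succ (n : ℕ) (f : UnitLat L (n + 1) → ℝ) :
    negLap L (n + 1) f = (f - lift n.le_succ (coarse L (n + 1) n f))
      + ((L : ℝ) ^ 2)⁻¹ • lift n.le_succ (negLap L n (coarse L (n + 1) n f)) := by
  ext x
  simp only [Pi.add_apply, Pi.smul_apply, smul_eq_mul, lift, negLap]
  rw [← Finset.add_sum_Ioc_eq_sum_Icc (Nat.le_add_left 1 n), fluct_one, Finset.mul_sum]
  congr 1
  · simp [lift]
  · rw [← Finset.Icc_add_one_left_eq_Ioc, ← Finset.map_add_right_Icc, Finset.sum_map]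
    refine Finset.sum_congr rfl fun k hk => ?_
    rw [Finset.mem_Icc] at hk
    obtain ⟨i, rfl⟩ := Nat.exists_eq_add_of_le' hk.2
    obtain ⟨k, rfl⟩ := Nat.exists_eq_add_of_le' hk.1
    simp only [addRightEmbedding_apply, Nat.add_sub_cancel]
    rw [← mul_assoc, ← mul_inv, ← pow_add, fluct_eq (i := i) (j := i + 1) (by omega) (by omega),
      fluct_eq (i := i) (j := i + 1) (by omega) (by omega), coarse_coarse (by omega) (by omega),
      coarse_coarse (by omega) (by omega)]
    simp only [Pi.sub_apply, lift, parent_parent]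
    congr 2
    ring_nf

/-- The finest fluctuation `P_1`. -/
def fine (n : ℕ) (f : UnitLat L (n + 1) → ℝ) : UnitLat L (n + 1) → ℝ :=
  f - lift n.le_succ (coarse L (n + 1) n f)

end Blocks

/-! ### Integrating out the finest fluctuation -/

section Fluctuation

variable {L : ℕ} [hL : Fact (Odd L)] {n : ℕ}

theorem fine_add (f g : UnitLat L (n + 1) → ℝ) : fine n (f + g) = fine n f + fine n g := by
  ext x; simp [fine, coarse_add, lift]; ring

theorem fine_smul (c : ℝ) (f : UnitLat L (n + 1) → ℝ) : fine n (c • f) = c • fine n f := by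
  ext x; simp [fine, coarse_smul, lift]; ring

theorem fine_sub (f g : UnitLat L (n + 1) → ℝ) : fine n (f - g) = fine n f - fine n g := by
  ext x; simp [fine, coarse_sub, lift]; ring

theorem coarse_fine (f : UnitLat L (n + 1) → ℝ) : coarse L (n + 1) n (fine n f) = 0 := by
  rw [fine, coarse_sub, coarse_lift, sub_self]

theorem fine_of_coarse_eq_zero {f : UnitLat L (n + 1) → ℝ} (h : coarse L (n + 1) n f = 0) :
    fine n f = f := by
  ext x; simp [fine, h, lift]

theorem fine_fine (f : UnitLat L (n + 1) → ℝ) : fine n (fine n f) = fine n f :=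
  fine_of_coarse_eq_zero (coarse_fine f)

theorem fine_one : fine n (1 : UnitLat L (n + 1) → ℝ) = 0 := by
  ext x; simp [fine, coarse_one, lift]

theorem fine_mul_lift (f : UnitLat L (n + 1) → ℝ) (g : UnitLat L n → ℝ) :
    fine n (f * lift n.le_succ g) = fine n f * lift n.le_succ g := by
  ext x; simp [fine, coarse_mul_lift, lift]; ring

theorem norm_fine_le (f : UnitLat L (n + 1) → ℝ) : ‖fine n f‖ ≤ 2 * ‖f‖ := by
  have := norm_sub_le f (lift n.le_succ (coarse L (n + 1) n f))
  have h2 := (norm_lift_le n.le_succ (coarse L (n + 1) n f)).trans (norm_coarse_le n.le_succ f)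
  rw [fine]
  linarith

omit hL in
theorem norm_one_le : ‖(1 : UnitLat L n → ℝ)‖ ≤ 1 :=
  (pi_norm_le_iff_of_nonneg zero_le_one).2 fun _ => by simp

/-- `w = Q_1 w + P_1 w` with `Q_1 w = 1` and `P_1 w = P_1 (F w)`: the factor by which a solution of
`-Δ_H v = F v + γ` differs from its block averages. -/
def IsFactor (n : ℕ) (F w : UnitLat L (n + 1) → ℝ) : Prop := w = 1 + fine n (F * w)

namespace IsFactor

variable {F F' w w' : UnitLat L (n + 1) → ℝ}

theorem coarse_eq_one (h : IsFactor n F w) : coarse L (n + 1) n w = 1 := by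
  rw [h, coarse_add, coarse_fine, coarse_one n.le_succ, add_zero]

theorem norm_sub_one_le' (h : IsFactor n F w) : ‖w - 1‖ ≤ 2 * (‖F‖ * ‖w‖) := by
  have : w - 1 = fine n (F * w) := by
    nth_rw 1 [h]; simp
  rw [this]
  exact (norm_fine_le _).trans (by gcongr; exact norm_mul_le _ _)

theorem norm_le (h : IsFactor n F w) (hF : ‖F‖ ≤ 1 / 8) : ‖w‖ ≤ 4 / 3 := by
  have h1 := h.norm_sub_one_le'
  have h2 := norm_add_le (w - 1) 1
  have h3 : ‖F‖ * ‖w‖ ≤ 1 / 8 * ‖w‖ := by gcongr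
  have h4 := norm_one_le (L := L) (n := n + 1)
  rw [sub_add_cancel] at h2
  linarith

theorem norm_sub_one_le (h : IsFactor n F w) (hF : ‖F‖ ≤ 1 / 8) : ‖w - 1‖ ≤ 3 * ‖F‖ := by
  have h1 := h.norm_sub_one_le'
  have h3 : ‖F‖ * ‖w‖ ≤ ‖F‖ * (4 / 3) := by gcongr; exact h.norm_le hF
  have := norm_nonneg F
  linarith

theorem norm_sub_le (h : IsFactor n F w) (h' : IsFactor n F' w') (hF : ‖F‖ ≤ 1 / 8)
    (hF' : ‖F'‖ ≤ 1 / 8) : ‖w - w'‖ ≤ 4 * ‖F - F'‖ := by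
  have e : w - w' = fine n ((F - F') * w + F' * (w - w')) := by
    nth_rw 1 [h, h']
    rw [add_sub_add_left_eq_sub, ← fine_sub]
    congr 1; ring
  have h1 : ‖w - w'‖ ≤ 2 * (‖F - F'‖ * ‖w‖ + ‖F'‖ * ‖w - w'‖) := by
    nth_rw 1 [e]
    refine (norm_fine_le _).trans ?_
    gcongr
    exact (norm_add_le _ _).trans (add_le_add (norm_mul_le _ _) (norm_mul_le _ _))
  have h2 : ‖F - F'‖ * ‖w‖ ≤ ‖F - F'‖ * (4 / 3) := by gcongr; exact h.norm_le hF
  have h3 : ‖F'‖ * ‖w - w'‖ ≤ 1 / 8 * ‖w - w'‖ := by gcongr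
  have := norm_nonneg (F - F')
  linarith

theorem norm_mul_sub_le (h : IsFactor n F w) (h' : IsFactor n F' w') (hF : ‖F‖ ≤ 1 / 8)
    (hF' : ‖F'‖ ≤ 1 / 8) : ‖F * w - F' * w'‖ ≤ 2 * ‖F - F'‖ := by
  have e : F * w - F' * w' = (F - F') * w + F' * (w - w') := by ring
  rw [e]
  refine (norm_add_le _ _).trans ((add_le_add (norm_mul_le _ _) (norm_mul_le _ _)).trans ?_)
  have h2 : ‖F - F'‖ * ‖w‖ ≤ ‖F - F'‖ * (4 / 3) := by gcongr; exact h.norm_le hF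
  have h3 : ‖F'‖ * ‖w - w'‖ ≤ 1 / 8 * (4 * ‖F - F'‖) := by
    gcongr; exact h.norm_sub_le h' hF hF'
  have := norm_nonneg (F - F')
  linarith

theorem unique (h : IsFactor n F w) (h' : IsFactor n F w') (hF : ‖F‖ ≤ 1 / 8) : w = w' := by
  have := h.norm_sub_le h' hF hF
  rw [sub_self, norm_zero, mul_zero] at this
  exact sub_eq_zero.1 (norm_le_zero_iff.1 this)

end IsFactor

theorem exists_isFactor {F : UnitLat L (n + 1) → ℝ} (hF : ‖F‖ ≤ 1 / 8) :
    ∃ w, IsFactor n F w := by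
  let T : (UnitLat L (n + 1) → ℝ) →ₗ[ℝ] (UnitLat L (n + 1) → ℝ) :=
    { toFun := fun w => w - fine n (F * w)
      map_add' := fun f g => by rw [mul_add, fine_add]; ring
      map_smul' := fun c f => by rw [mul_smul_comm, fine_smul, RingHom.id_apply, smul_sub] }
  have hinj : Function.Injective T := by
    rw [← LinearMap.ker_eq_bot, LinearMap.ker_eq_bot']
    intro w hw
    have e : w = fine n (F * w) := sub_eq_zero.1 hw
    have h1 : ‖w‖ ≤ 2 * (‖F‖ * ‖w‖) := by
      nth_rw 1 [e]
      exact (norm_fine_le _).trans (by gcongr; exact norm_mul_le _ _)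
    have h3 : ‖F‖ * ‖w‖ ≤ 1 / 8 * ‖w‖ := by gcongr
    exact norm_le_zero_iff.1 (by linarith [norm_nonneg w])
  obtain ⟨w, hw⟩ := LinearMap.injective_iff_surjective.1 hinj 1
  exact ⟨w, sub_eq_iff_eq_add.1 hw⟩

/-- The factor of `IsFactor`, which exists and is unique for small forces. -/
def factor (n : ℕ) (F : UnitLat L (n + 1) → ℝ) : UnitLat L (n + 1) → ℝ :=
  Classical.epsilon (IsFactor n F)

theorem isFactor_factor {F : UnitLat L (n + 1) → ℝ} (hF : ‖F‖ ≤ 1 / 8) :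
    IsFactor n F (factor n F) := Classical.epsilon_spec (exists_isFactor hF)

/-- The function `w * b` with `b` constant on blocks solves the equation on `Λ^(n+1)` if and only if
`b` solves the equation on `Λ^n` with the renormalized force `L² Q_1 (F w)`. -/
theorem IsFactor.negLap_mul_lift_iff {F w : UnitLat L (n + 1) → ℝ} (h : IsFactor n F w)
    (b : UnitLat L n → ℝ) (γ : ℝ) :
    negLap L (n + 1) (w * lift n.le_succ b) = F * (w * lift n.le_succ b) + (fun _ => γ) ↔
      negLap L n b =
        ((L : ℝ) ^ 2 • coarse L (n + 1) n (F * w)) * b + (fun _ => (L : ℝ) ^ 2 * γ) := by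
  have hp := side_pos L
  have hc : coarse L (n + 1) n (w * lift n.le_succ b) = b := by
    rw [coarse_mul_lift, h.coarse_eq_one, one_mul]
  rw [negLap_succ, hc]
  have key : ∀ y, (w * lift n.le_succ b - lift n.le_succ b) y
      = (F * (w * lift n.le_succ b)) y
        - coarse L (n + 1) n (F * w) (parent n.le_succ y) * b (parent n.le_succ y) := by
    intro y
    have := congrFun h y
    simp only [Pi.add_apply, fine, Pi.sub_apply, lift, Pi.one_apply, Pi.mul_apply] at this ⊢
    linear_combination b (parent n.le_succ y) * this
  constructor
  · intro h1
    have h2 := congrArg (coarse L (n + 1) n) h1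
    ext x
    have h3 := congrFun h2 x
    have e1 : w * lift n.le_succ b - lift n.le_succ b
        = F * (w * lift n.le_succ b) - lift n.le_succ (coarse L (n + 1) n (F * w) * b) := by
      ext y; exact key y
    have e2 : (fun _ => γ : UnitLat L (n + 1) → ℝ) = γ • 1 := by ext; simp
    rw [e1, e2, coarse_add, coarse_add, coarse_sub, coarse_lift, coarse_smul, coarse_smul,
      coarse_lift, coarse_one n.le_succ] at h3
    simp only [Pi.add_apply, Pi.sub_apply, Pi.smul_apply, smul_eq_mul, Pi.mul_apply,
      Pi.one_apply] at h3 ⊢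
    have hne : (L : ℝ) ^ 2 ≠ 0 := by positivity
    field_simp at h3
    linear_combination h3
  · intro h1
    ext y
    have h2 := congrFun h1 (parent n.le_succ y)
    simp only [Pi.add_apply, Pi.smul_apply, smul_eq_mul, key, lift, Pi.mul_apply] at h2 ⊢
    rw [h2]
    field_simp
    ring

/-- A solution on `Λ^(n+1)` is its block average times the factor. -/
theorem IsFactor.eq_mul_lift_coarse {F w v : UnitLat L (n + 1) → ℝ} (h : IsFactor n F w)
    (hF : ‖F‖ ≤ 1 / 8) {γ : ℝ} (hv : negLap L (n + 1) v = F * v + (fun _ => γ)) :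
    v = w * lift n.le_succ (coarse L (n + 1) n v) := by
  have hv1 : fine n v = fine n (F * v) := by
    have h1 := congrArg (fine n) hv
    have e2 : (fun _ => γ : UnitLat L (n + 1) → ℝ) = γ • 1 := by ext; simp
    have e3 : ∀ b : UnitLat L n → ℝ, fine n (lift n.le_succ b) = 0 := by
      intro b; rw [fine, coarse_lift, sub_self]
    have e4 : v - lift n.le_succ (coarse L (n + 1) n v) = fine n v := rfl
    rw [negLap_succ, e2, e4, fine_add, fine_add, fine_smul, fine_smul, e3, fine_one, fine_fine] at h1
    simpa using h1
  set b := coarse L (n + 1) n v with hb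
  have e : v - w * lift n.le_succ b = fine n (F * (v - w * lift n.le_succ b)) := by
    rw [mul_sub, fine_sub, ← hv1, ← mul_assoc, fine_mul_lift]
    have h5 : fine n (F * w) = w - 1 := by nth_rw 2 [h]; simp
    rw [h5, fine, ← hb]
    ring
  have h1 : ‖v - w * lift n.le_succ b‖ ≤ 2 * (‖F‖ * ‖v - w * lift n.le_succ b‖) := by
    nth_rw 1 [e]
    exact (norm_fine_le _).trans (by gcongr; exact norm_mul_le _ _)
  have h3 : ‖F‖ * ‖v - w * lift n.le_succ b‖ ≤ 1 / 8 * ‖v - w * lift n.le_succ b‖ := by gcongr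
  exact sub_eq_zero.1 (norm_le_zero_iff.1
    (by linarith [norm_nonneg (v - w * lift n.le_succ b)]))

end Fluctuation

/-! ### Solving the equation scale by scale -/

section Solve

variable {L : ℕ} [hL : Fact (Odd L)]

/-- The solutions on all lattices, built up from the one on the single point of `Λ^0`: the block
averages of the solution on `Λ^(n+1)` are `L` times the solution on `Λ^n`. -/
def sol (F w : Traj L) : Traj L
  | 0 => -(F 0)⁻¹
  | n + 1 => (L : ℝ) • (w (n + 1) * lift n.le_succ (sol F w n))

/-- Forces and factors on `Λ^0, …, Λ^N` that are linked by the renormalization step. -/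
structure IsForceFlow (N : ℕ) (F w : Traj L) : Prop where
  ne_zero : ∀ x, F 0 x ≠ 0
  isFactor : ∀ n < N, IsFactor n (F (n + 1)) (w (n + 1))
  step : ∀ n < N, F n = (L : ℝ) ^ 2 • coarse L (n + 1) n (F (n + 1) * w (n + 1))

theorem gamC_succ (n : ℕ) : (L : ℝ) ^ 2 * gamC L (n + 1) = L * gamC L n := by
  have := side_pos L
  unfold gamC
  field_simp
  ring

theorem negLap_smul (n : ℕ) (c : ℝ) (f : UnitLat L n → ℝ) :
    negLap L n (c • f) = c • negLap L n f := by
  induction n with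
  | zero => simp [negLap_zero]
  | succ n ih =>
    rw [negLap_succ, negLap_succ, coarse_smul, ih]
    ext y
    simp [lift]
    ring

variable {N : ℕ} {F w : Traj L}

theorem IsForceFlow.negLap_sol (h : IsForceFlow N F w) {n : ℕ} (hn : n ≤ N) :
    negLap L n (sol F w n) = F n * sol F w n + fun _ => gamC L n := by
  induction n with
  | zero =>
    rw [negLap_zero]
    ext x
    have := h.ne_zero x
    simp [sol, gamC, this]
  | succ n ih =>
    have e : sol F w (n + 1) = w (n + 1) * lift n.le_succ ((L : ℝ) • sol F w n) := by
      ext y; simp [sol, lift]; ring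
    rw [e, (h.isFactor n hn).negLap_mul_lift_iff, ← h.step n hn, negLap_smul, ih (by omega),
      gamC_succ]
    ext y
    simp
    ring

theorem IsForceFlow.eq_sol (h : IsForceFlow N F w) (hF : ∀ n < N, ‖F (n + 1)‖ ≤ 1 / 8) {n : ℕ}
    (hn : n ≤ N) {v : UnitLat L n → ℝ} (hv : negLap L n v = F n * v + fun _ => gamC L n) :
    v = sol F w n := by
  induction n with
  | zero =>
    rw [negLap_zero] at hv
    ext x
    have h1 := congrFun hv x
    have h2 := h.ne_zero x
    simp only [gamC, pow_zero, inv_one, Pi.zero_apply, Pi.add_apply, Pi.mul_apply] at h1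
    simp only [sol, Pi.neg_apply, Pi.inv_apply]
    field_simp
    linarith
  | succ n ih =>
    have hp := side_pos L
    have e := (h.isFactor n hn).eq_mul_lift_coarse (hF n hn) hv
    set b := coarse L (n + 1) n v
    have hb := hv
    rw [e, (h.isFactor n hn).negLap_mul_lift_iff, ← h.step n hn, gamC_succ] at hb
    have hb' : (L : ℝ)⁻¹ • b = sol F w n := by
      refine ih (by omega) ?_
      rw [negLap_smul, hb]
      ext x
      simp
      field_simp
    rw [e, sol, ← hb']
    ext y
    simp [lift]
    field_simp

theorem IsForceFlow.coarse_sol (h : IsForceFlow N F w) {m n : ℕ} (hn : n ≤ m) (hm : m ≤ N) :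
    coarse L m n (sol F w m) = (L : ℝ) ^ (m - n) • sol F w n := by
  induction m, hn using Nat.le_induction with
  | base => simp [coarse_self]
  | succ m hn ih =>
    rw [← coarse_coarse m.le_succ hn, sol, coarse_smul, coarse_mul_lift,
      (h.isFactor m hm).coarse_eq_one, one_mul, coarse_smul, ih (by omega), smul_smul,
      ← pow_succ', Nat.succ_sub hn]

end Solve

/-! ### The effective force and the remainder flow -/

section Force

variable {L : ℕ} [hL : Fact (Odd L)]

theorem lamC_succ (g : ℝ) (n : ℕ) : lamC L g n = L * lamC L g (n + 1) := by
  have := side_pos L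
  unfold lamC
  field_simp
  ring

/-- The mass counterterm compensates the expectation of `ξ P_1 ξ`. -/
theorem muC_succ (r g : ℝ) (n : ℕ) :
    muC L r g n = (L : ℝ) ^ 2 * muC L r g (n + 1)
      + (L : ℝ) ^ 2 * lamC L g (n + 1) ^ 2 * (1 - ((L : ℝ) ^ 2)⁻¹) := by
  have := side_pos L
  unfold lamC muC
  push_cast
  field_simp
  ring

/-- The scale consistency of a realisation of the noise and of its second chaos. -/
structure IsEnhancedNoise (ξ : Traj L) (Ξ : ℕ → Traj L) : Prop where
  noise : ∀ n, ξ n = (L : ℝ) • coarse L (n + 1) n (ξ (n + 1))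
  chaos_self : ∀ N, Ξ N N = 0
  chaos : ∀ N n, n < N → Ξ N n = coarse L (n + 1) n (Ξ N (n + 1))
    + coarse L (n + 1) n (ξ (n + 1) * fine n (ξ (n + 1))) - fun _ => 1 - ((L : ℝ) ^ 2)⁻¹

/-- The force `λ ξ + λ² Ξ + λ³ Ψ + μ` on `Λ^n`. -/
def totalForce (r g : ℝ) (ξ Ξ Ψ : Traj L) (n : ℕ) : UnitLat L n → ℝ :=
  lamC L g n • ξ n + lamC L g n ^ 2 • Ξ n + lamC L g n ^ 3 • Ψ n + muC L r g n • 1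

/-- The factor `1 + λ P_1 ξ + λ² R` on `Λ^(n+1)`. -/
def totalFactor (g : ℝ) (ξ R : Traj L) (n : ℕ) : UnitLat L (n + 1) → ℝ :=
  1 + (lamC L g (n + 1) • fine n (ξ (n + 1)) + lamC L g (n + 1) ^ 2 • R (n + 1))

/-- The equation for the fluctuation remainder `R` says that `1 + λ P_1 ξ + λ² R` is the factor of
the force `λ ξ + λ² Ξ + λ³ Ψ + μ`. -/
theorem rem_eq_iff_isFactor {r g : ℝ} {ξ Ξ Ψ R : Traj L} {n : ℕ} (hl : lamC L g (n + 1) ≠ 0)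
    (hm : muC L r g (n + 1) ≠ 1) :
    (∀ x, R (n + 1) x =
      fluct L (n + 1) 1 (Ξ (n + 1)) x
      + fluct L (n + 1) 1 (ξ (n + 1) * fluct L (n + 1) 1 (ξ (n + 1))) x
      + lamC L g (n + 1) * fluct L (n + 1) 1 (Ψ (n + 1)) x
      + lamC L g (n + 1) * fluct L (n + 1) 1 (ξ (n + 1) * R (n + 1)) x
      + lamC L g (n + 1) * fluct L (n + 1) 1 (Ξ (n + 1) * fluct L (n + 1) 1 (ξ (n + 1))) x
      + lamC L g (n + 1) ^ 2 * fluct L (n + 1) 1 (Ξ (n + 1) * R (n + 1)) x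
      + lamC L g (n + 1) ^ 2 * fluct L (n + 1) 1 (Ψ (n + 1) * fluct L (n + 1) 1 (ξ (n + 1))) x
      + lamC L g (n + 1) ^ 3 * fluct L (n + 1) 1 (Ψ (n + 1) * R (n + 1)) x
      + muC L r g (n + 1) * (lamC L g (n + 1))⁻¹ * fluct L (n + 1) 1 (ξ (n + 1)) x
      + muC L r g (n + 1) * R (n + 1) x) ↔
    IsFactor n (totalForce r g ξ Ξ Ψ (n + 1)) (totalFactor g ξ R n) := by
  have hfl : ∀ f, fluct L (n + 1) 1 f = fine n f := fluct_one n
  simp only [hfl, totalForce, totalFactor]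
  generalize lamC L g (n + 1) = l at *
  generalize muC L r g (n + 1) = μ at *
  generalize ξ (n + 1) = a
  generalize Ξ (n + 1) = b
  generalize Ψ (n + 1) = c
  generalize R (n + 1) = R
  set ρ := l • fine n a + l ^ 2 • R with hρ
  set X := l • a + l ^ 2 • b + l ^ 3 • c with hX
  have hexp : fine n (X * (1 + ρ)) = l • fine n a + l ^ 2 • fine n b + l ^ 3 • fine n c
      + l ^ 2 • fine n (a * fine n a) + l ^ 3 • fine n (a * R) + l ^ 3 • fine n (b * fine n a)
      + l ^ 4 • fine n (b * R) + l ^ 4 • fine n (c * fine n a) + l ^ 5 • fine n (c * R) := by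
    have : X * (1 + ρ) = l • a + l ^ 2 • b + l ^ 3 • c
      + l ^ 2 • (a * fine n a) + l ^ 3 • (a * R) + l ^ 3 • (b * fine n a)
      + l ^ 4 • (b * R) + l ^ 4 • (c * fine n a) + l ^ 5 • (c * R) := by
      ext y; simp [hX, hρ]; ring
    rw [this]
    simp only [fine_add, fine_smul]
  have hB : IsFactor n (X + μ • 1) (1 + ρ) ↔ ρ = fine n (X * (1 + ρ)) + μ • fine n ρ := by
    have : (X + μ • 1) * (1 + ρ) = X * (1 + ρ) + μ • 1 + μ • ρ := by
      ext y; simp; ring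
    rw [IsFactor, this, fine_add, fine_add, fine_smul, fine_smul, fine_one, smul_zero, add_zero,
      add_right_inj]
  have hA : ρ = fine n (X * (1 + ρ)) + μ • ρ ↔ ρ = fine n (X * (1 + ρ)) + μ • fine n ρ := by
    constructor <;> intro h
    · -- `(1 - μ) ρ` is a fluctuation, hence so is `ρ`.
      have h1 : (1 - μ) • ρ = fine n (X * (1 + ρ)) := by
        rw [sub_smul, one_smul, sub_eq_iff_eq_add]; exact h
      have h2 : (1 - μ) • fine n ρ = (1 - μ) • ρ := by
        rw [← fine_smul, h1, fine_fine]
      have h3 := smul_right_injective _ (sub_ne_zero.2 hm.symm) h2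
      rwa [h3]
    · have h1 : fine n ρ = ρ := by
        rw [h, fine_add, fine_smul, fine_fine, fine_fine]
      rw [h1] at h
      exact h
  rw [hB, ← hA, hexp, funext_iff]
  refine forall_congr' fun x => ?_
  have e1 : l ^ 2 * l⁻¹ = l := by field_simp
  simp only [hρ, Pi.add_apply, Pi.smul_apply, smul_eq_mul]
  constructor
  · intro h
    linear_combination l ^ 2 * h + μ * fine n a x * e1
  · intro h
    refine mul_left_cancel₀ (pow_ne_zero 2 hl) ?_
    linear_combination h - μ * fine n a x * e1

/-- The recursion for the remainder `Ψ` says that the force `λ ξ + λ² Ξ + λ³ Ψ + μ` follows the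
renormalization step. -/
theorem psi_eq_iff_step {r g : ℝ} {ξ Ψ R : Traj L} {Ξ : ℕ → Traj L} (hN : IsEnhancedNoise ξ Ξ)
    {n N : ℕ} (hn : n < N) (hl : lamC L g (n + 1) ≠ 0)
    (hw : coarse L (n + 1) n (totalFactor g ξ R n) = 1) :
    (∀ x, Ψ n x = (L : ℝ)⁻¹ *
      (coarse L (n + 1) n (Ψ (n + 1)) x
      + coarse L (n + 1) n (ξ (n + 1) * R (n + 1)) x
      + coarse L (n + 1) n (Ξ N (n + 1) * fluct L (n + 1) 1 (ξ (n + 1))) x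
      + lamC L g (n + 1) * coarse L (n + 1) n (Ξ N (n + 1) * R (n + 1)) x
      + lamC L g (n + 1) * coarse L (n + 1) n (Ψ (n + 1) * fluct L (n + 1) 1 (ξ (n + 1))) x
      + lamC L g (n + 1) ^ 2 * coarse L (n + 1) n (Ψ (n + 1) * R (n + 1)) x)) ↔
    totalForce r g ξ (Ξ N) Ψ n = (L : ℝ) ^ 2 •
      coarse L (n + 1) n (totalForce r g ξ (Ξ N) Ψ (n + 1) * totalFactor g ξ R n) := by
  have hp := side_pos L
  have hfl : ∀ f, fluct L (n + 1) 1 f = fine n f := fluct_one n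
  have h1 := hN.noise n
  have h2 := hN.chaos N n hn
  simp only [hfl]
  rw [totalForce, h1, h2, lamC_succ g n, muC_succ r g n, totalForce, funext_iff]
  rw [totalFactor, coarse_add, coarse_one n.le_succ, add_eq_left] at hw
  rw [totalFactor]
  generalize lamC L g (n + 1) = l at *
  generalize muC L r g (n + 1) = μ at *
  clear h1 h2
  generalize ξ (n + 1) = a at *
  generalize Ξ N (n + 1) = b at *
  generalize Ψ (n + 1) = c at *
  generalize R (n + 1) = R at *
  refine forall_congr' fun x => ?_
  have hexp : (l • a + l ^ 2 • b + l ^ 3 • c + μ • 1) * (1 + (l • fine n a + l ^ 2 • R))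
      = l • a + l ^ 2 • b + l ^ 3 • c
      + l ^ 2 • (a * fine n a) + l ^ 3 • (a * R) + l ^ 3 • (b * fine n a)
      + l ^ 4 • (b * R) + l ^ 4 • (c * fine n a) + l ^ 5 • (c * R) + μ • 1
      + μ • (l • fine n a + l ^ 2 • R) := by
    ext y; simp; ring
  rw [hexp]
  simp only [coarse_add _ _ _ (μ • (l • fine n a + l ^ 2 • R)),
    coarse_smul _ _ _ (l • fine n a + l ^ 2 • R), hw]
  simp only [coarse_add, coarse_smul, coarse_one n.le_succ]
  simp only [Pi.add_apply, Pi.sub_apply, Pi.smul_apply, smul_eq_mul, Pi.one_apply, Pi.zero_apply]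
  have e1 : (L : ℝ) * (L : ℝ)⁻¹ = 1 := by field_simp
  constructor
  · intro h
    rw [h]
    linear_combination (L : ℝ) ^ 2 * l ^ 3 * (coarse L (n + 1) n c x
      + coarse L (n + 1) n (a * R) x + coarse L (n + 1) n (b * fine n a) x
      + l * coarse L (n + 1) n (b * R) x + l * coarse L (n + 1) n (c * fine n a) x
      + l ^ 2 * coarse L (n + 1) n (c * R) x) * e1
  · intro h
    have hne : (L : ℝ) ^ 3 * l ^ 3 ≠ 0 := by positivity
    refine mul_left_cancel₀ hne ?_
    linear_combination h - (L : ℝ) ^ 2 * l ^ 3 * (coarse L (n + 1) n c x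
      + coarse L (n + 1) n (a * R) x + coarse L (n + 1) n (b * fine n a) x
      + l * coarse L (n + 1) n (b * R) x + l * coarse L (n + 1) n (c * fine n a) x
      + l ^ 2 * coarse L (n + 1) n (c * R) x) * e1

/-- The effective force `F^{(N)}_{-n}`: it starts from `λ ξ + μ` at `n = N` and follows the
renormalization step down to `n = 0`.  For `n > N` the value is irrelevant. -/
def force (r g : ℝ) (ξ : Traj L) (N n : ℕ) : UnitLat L n → ℝ :=
  if N ≤ n then lamC L g n • ξ n + muC L r g n • 1
  else (L : ℝ) ^ 2 • coarse L (n + 1) n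
    (force r g ξ N (n + 1) * factor n (force r g ξ N (n + 1)))
termination_by N - n

/-- The factors that belong to the effective forces. -/
def forceFactor (r g : ℝ) (ξ : Traj L) (N : ℕ) : Traj L
  | 0 => 1
  | n + 1 => factor n (force r g ξ N (n + 1))

/-- The part `λ³ Ψ` of the effective force. -/
def forceRem (r g : ℝ) (ξ : Traj L) (Ξ : ℕ → Traj L) (N n : ℕ) : UnitLat L n → ℝ :=
  force r g ξ N n - lamC L g n • ξ n - lamC L g n ^ 2 • Ξ N n - muC L r g n • 1

/-- The remainder `Ψ^{(N)}`. -/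
def flowPsi (r g : ℝ) (ξ : Traj L) (Ξ : ℕ → Traj L) (N n : ℕ) : UnitLat L n → ℝ :=
  if N ≤ n then 0 else (lamC L g n ^ 3)⁻¹ • forceRem r g ξ Ξ N n

/-- The fluctuation remainder `R^{(N)}`. -/
def flowRem (r g : ℝ) (ξ : Traj L) (N : ℕ) : Traj L
  | 0 => 0
  | n + 1 => if N ≤ n then 0 else
      (lamC L g (n + 1) ^ 2)⁻¹ •
        (factor n (force r g ξ N (n + 1)) - 1 - lamC L g (n + 1) • fine n (ξ (n + 1)))

variable {r g : ℝ} {ξ : Traj L} {Ξ : ℕ → Traj L} {N : ℕ}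

theorem force_of_lt {n : ℕ} (h : n < N) : force r g ξ N n = (L : ℝ) ^ 2 • coarse L (n + 1) n
    (force r g ξ N (n + 1) * factor n (force r g ξ N (n + 1))) := by
  rw [force, if_neg (not_le.2 h)]

theorem force_self (r g : ℝ) (ξ : Traj L) (N : ℕ) :
    force r g ξ N N = lamC L g N • ξ N + muC L r g N • 1 := by
  rw [force, if_pos le_rfl]

theorem totalForce_flowPsi (hN : IsEnhancedNoise ξ Ξ) (hl : ∀ n, lamC L g n ≠ 0) {n : ℕ}
    (hn : n ≤ N) : totalForce r g ξ (Ξ N) (flowPsi r g ξ Ξ N) n = force r g ξ N n := by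
  rcases hn.eq_or_lt with rfl | hn
  · rw [totalForce, flowPsi, if_pos le_rfl, force_self, hN.chaos_self]
    simp
  · rw [totalForce, flowPsi, if_neg (not_le.2 hn), smul_smul,
      mul_inv_cancel₀ (pow_ne_zero 3 (hl n)), one_smul, forceRem]
    abel

theorem totalFactor_flowRem (hl : ∀ n, lamC L g n ≠ 0) {n : ℕ} (hn : n < N) :
    totalFactor g ξ (flowRem r g ξ N) n = factor n (force r g ξ N (n + 1)) := by
  rw [totalFactor, flowRem, if_neg (not_le.2 hn), smul_smul,
      mul_inv_cancel₀ (pow_ne_zero 2 (hl _)), one_smul]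
  abel

/-- The remainder flow has exactly one solution as long as the effective forces are small. -/
theorem isRemainderFlow_iff (hN : IsEnhancedNoise ξ Ξ) (hl : ∀ n, lamC L g n ≠ 0)
    (hm : ∀ n, muC L r g (n + 1) ≠ 1) (hF : ∀ n < N, ‖force r g ξ N (n + 1)‖ ≤ 1 / 8)
    (Ψ R : Traj L) :
    IsRemainderFlow L r g N ξ (Ξ N) Ψ R ↔ Ψ = flowPsi r g ξ Ξ N ∧ R = flowRem r g ξ N := by
  constructor
  · intro h
    have hfac : ∀ n < N, IsFactor n (totalForce r g ξ (Ξ N) Ψ (n + 1)) (totalFactor g ξ R n) :=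
      fun n hn => (rem_eq_iff_isFactor (hl _) (hm _)).1 (h.rem_eq (n + 1) (by omega) hn)
    have hforce : ∀ n ≤ N, totalForce r g ξ (Ξ N) Ψ n = force r g ξ N n := by
      intro n hn
      induction hn using Nat.decreasingInduction with
      | self =>
        rw [totalForce, h.psi_zero N le_rfl, hN.chaos_self, force_self]
        simp
      | of_succ n hn ih =>
        have h1 := hfac n hn
        have h2 := (psi_eq_iff_step (r := r) hN hn (hl _) h1.coarse_eq_one).1 (h.psi_eq n hn)
        rw [ih] at h1 h2
        rw [h2, force_of_lt hn, h1.unique (isFactor_factor (hF n hn)) (hF n hn)]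
    constructor
    · funext n
      rcases le_or_gt N n with hn | hn
      · rw [h.psi_zero n hn, flowPsi, if_pos hn]
      · rw [flowPsi, if_neg (not_le.2 hn), forceRem, ← hforce n hn.le,
          eq_inv_smul_iff₀ (pow_ne_zero 3 (hl n)), totalForce]
        abel
    · funext n
      match n with
      | 0 => exact h.rem_zero 0 (Or.inl rfl)
      | n + 1 =>
        rcases le_or_gt N n with hn | hn
        · rw [h.rem_zero (n + 1) (Or.inr (by omega)), flowRem, if_pos hn]
        · have h1 := hfac n hn
          rw [hforce _ hn] at h1
          rw [flowRem, if_neg (not_le.2 hn), eq_inv_smul_iff₀ (pow_ne_zero 2 (hl _)),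
            ← h1.unique (isFactor_factor (hF n hn)) (hF n hn), totalFactor]
          abel
  · rintro ⟨rfl, rfl⟩
    have hfac : ∀ n < N, IsFactor n (totalForce r g ξ (Ξ N) (flowPsi r g ξ Ξ N) (n + 1))
        (totalFactor g ξ (flowRem r g ξ N) n) := by
      intro n hn
      rw [totalForce_flowPsi hN hl hn, totalFactor_flowRem hl hn]
      exact isFactor_factor (hF n hn)
    refine ⟨fun n hn => ?_, fun n hn => ?_, fun n h1 hn => ?_, fun n hn => ?_⟩
    · rw [flowPsi, if_pos hn]
    · match n with
      | 0 => rfl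
      | n + 1 => rw [flowRem, if_pos (by omega)]
    · obtain ⟨n, rfl⟩ := Nat.exists_eq_add_of_le' h1
      exact (rem_eq_iff_isFactor (hl _) (hm _)).2 (hfac n hn)
    · refine (psi_eq_iff_step (r := r) hN hn (hl _) (hfac n hn).coarse_eq_one).2 ?_
      rw [totalForce_flowPsi hN hl hn, totalForce_flowPsi hN hl (Nat.le_of_succ_le hn),
        totalFactor_flowRem hl hn, force_of_lt hn]

/-! ### Bounds on the effective force -/

/-- Smallness of the enhanced noise at the coupling `g`, measured by powers of a small positive
number `s` of the order of `λ_{-1} ξ_{-1}`. The condition `cube` makes the renormalization step a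
contraction for terms of third order. -/
structure IsSmall (r g s : ℝ) (ξ : Traj L) (Ξ : ℕ → Traj L) : Prop where
  pos : 0 < s
  le : s ≤ 1 / 16
  cube : (L : ℝ) ^ 2 * s ^ 3 ≤ 1 / 48
  noise : ∀ n, ‖lamC L g n • ξ n‖ ≤ s ^ n / 2
  chaos : ∀ N n, n ≤ N → ‖lamC L g n ^ 2 • Ξ N n‖ ≤ (s ^ n) ^ 2 / 4
  mass : ∀ n, |muC L r g (n + 1)| ≤ s ^ (n + 1) / 4
  one_le : 1 ≤ r

omit hL in
theorem IsSmall.mass_ne_one (h : IsSmall r g s ξ Ξ) (n : ℕ) : muC L r g (n + 1) ≠ 1 := by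
  have h1 := h.mass n
  have h2 : s ^ (n + 1) ≤ 1 := pow_le_one₀ h.pos.le (by linarith [h.le])
  intro h3
  rw [h3, abs_one] at h1
  linarith

omit hL in
theorem norm_smul_one_le (n : ℕ) (c : ℝ) : ‖c • (1 : UnitLat L n → ℝ)‖ ≤ |c| := by
  rw [norm_smul, Real.norm_eq_abs]
  exact mul_le_of_le_one_right (abs_nonneg _) norm_one_le

theorem IsSmall.norm_force_le (h : IsSmall r g s ξ Ξ) {n : ℕ} (hn : n + 1 ≤ N)
    (hψ : ‖forceRem r g ξ Ξ N (n + 1)‖ ≤ 7 * ((L : ℝ) ^ 2 * s ^ 3) * (s ^ (n + 1)) ^ 3) :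
    ‖force r g ξ N (n + 1)‖ ≤ 5 / 4 * s ^ (n + 1) := by
  have e : force r g ξ N (n + 1) = lamC L g (n + 1) • ξ (n + 1)
      + lamC L g (n + 1) ^ 2 • Ξ N (n + 1) + muC L r g (n + 1) • 1
      + forceRem r g ξ Ξ N (n + 1) := by
    rw [forceRem]; abel
  have h1 := h.noise (n + 1)
  have h2 := h.chaos N (n + 1) hn
  have h3 := (norm_smul_one_le (L := L) (n + 1) (muC L r g (n + 1))).trans (h.mass n)
  have ha : 0 < s ^ (n + 1) := pow_pos h.pos _
  have ha1 : s ^ (n + 1) ≤ 1 := pow_le_one₀ h.pos.le (by linarith [h.le])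
  have h4 := norm_add₄_le (a := lamC L g (n + 1) • ξ (n + 1))
    (b := lamC L g (n + 1) ^ 2 • Ξ N (n + 1)) (c := muC L r g (n + 1) • 1)
    (d := forceRem r g ξ Ξ N (n + 1))
  rw [← e] at h4
  have hc := h.cube
  generalize s ^ (n + 1) = a at *
  have h5 : a ^ 2 ≤ a := by nlinarith
  have h6 : 7 * ((L : ℝ) ^ 2 * s ^ 3) * a ^ 3 ≤ a / 4 := by
    have : a ^ 3 ≤ a := by nlinarith
    have h7 : 0 < a ^ 3 := by positivity
    nlinarith
  linarith

/-- The remainder `λ³ Ψ` is of third order in the size `s ^ n` of `λ ξ`: the step multiplies it by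
`L²` and adds terms of third order, and `L² s³` is small. -/
theorem IsSmall.norm_forceRem_le (h : IsSmall r g s ξ Ξ) (hN : IsEnhancedNoise ξ Ξ) {n : ℕ}
    (hn : n ≤ N) : ‖forceRem r g ξ Ξ N n‖ ≤ 7 * ((L : ℝ) ^ 2 * s ^ 3) * (s ^ n) ^ 3 := by
  have hs := h.pos
  induction hn using Nat.decreasingInduction with
  | self =>
    rw [forceRem, force_self, hN.chaos_self]
    simp only [smul_zero, sub_zero, add_sub_cancel_left, sub_self, norm_zero]
    positivity
  | of_succ n hn ih =>
    have hFle := h.norm_force_le hn ih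
    have ha : 0 < s ^ (n + 1) := pow_pos h.pos _
    have ha1 : s ^ (n + 1) ≤ 1 / 16 :=
      (pow_le_of_le_one h.pos.le (by linarith [h.le]) (by omega)).trans h.le
    have hF8 : ‖force r g ξ N (n + 1)‖ ≤ 1 / 8 := by linarith
    have hfac := isFactor_factor hF8
    have h1 := h.noise (n + 1)
    have h2 := h.chaos N (n + 1) hn
    have hc := h.cube
    set F := force r g ξ N (n + 1) with hFdef
    set w := factor n F with hw
    set η := lamC L g (n + 1) • ξ (n + 1) with hη
    set χ := lamC L g (n + 1) ^ 2 • Ξ N (n + 1) with hχ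
    set ψ := forceRem r g ξ Ξ N (n + 1) with hψ
    have hFe : F = η + χ + ψ + muC L r g (n + 1) • 1 := by rw [hψ, forceRem]; abel
    have hρ : ‖w - 1‖ ≤ 15 / 4 * s ^ (n + 1) := by
      have := hfac.norm_sub_one_le hF8
      linarith
    have hσe : w - 1 - fine n η = fine n (χ + ψ + F * (w - 1)) := by
      have e1 : w - 1 = fine n (F * w) := by nth_rw 1 [hfac]; simp
      have e2 : F * w = η + (χ + ψ + F * (w - 1)) + muC L r g (n + 1) • 1 := by
        have : F * w = F + F * (w - 1) := by ring
        rw [this]; nth_rw 1 [hFe]; abel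
      have e3 : w - 1 = fine n η + fine n (χ + ψ + F * (w - 1)) := by
        calc w - 1 = fine n (F * w) := e1
          _ = _ := by
            rw [e2, fine_add, fine_add, fine_smul (muC L r g (n + 1)), fine_one, smul_zero,
              add_zero]
      rw [sub_eq_iff_eq_add']
      exact e3
    have hψ1 : ‖ψ‖ ≤ (s ^ (n + 1)) ^ 2 / 8 := by
      refine ih.trans ?_
      generalize s ^ (n + 1) = a at *
      nlinarith [pow_pos ha 2, mul_pos (pow_pos ha 2) (sub_pos.2 (lt_of_le_of_lt ha1
        (by norm_num : (1 / 16 : ℝ) < 1))), pow_pos ha 3]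
    have hσ : ‖w - 1 - fine n η‖ ≤ 41 / 4 * (s ^ (n + 1)) ^ 2 := by
      rw [hσe]
      refine (norm_fine_le _).trans ?_
      have h5 : ‖F * (w - 1)‖ ≤ 5 / 4 * s ^ (n + 1) * (15 / 4 * s ^ (n + 1)) :=
        (norm_mul_le _ _).trans (by gcongr)
      have h6 := norm_add₃_le (a := χ) (b := ψ) (c := F * (w - 1))
      nlinarith
    -- The terms of first and second order are those of the recursions for `ξ` and `Ξ`; the term
    -- `μ (w - 1)` averages to zero.
    have hstep : forceRem r g ξ Ξ N n = (L : ℝ) ^ 2 • coarse L (n + 1) n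
        (ψ * w + η * (w - 1 - fine n η) + χ * (w - 1)) := by
      have e1 : coarse L (n + 1) n (w - 1) = 0 := by
        rw [coarse_sub, hfac.coarse_eq_one, coarse_one n.le_succ, sub_self]
      have e2 : F * w = η + χ + muC L r g (n + 1) • (1 : UnitLat L (n + 1) → ℝ) + η * fine n η
          + muC L r g (n + 1) • (w - 1)
          + (ψ * w + η * (w - 1 - fine n η) + χ * (w - 1)) := by
        have e3 : muC L r g (n + 1) • w
            = muC L r g (n + 1) • (1 : UnitLat L (n + 1) → ℝ) + muC L r g (n + 1) • (w - 1) := by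
          rw [← smul_add]; congr 1; ring
        have e4 : F * w = (η + χ + ψ) * w + muC L r g (n + 1) • w := by
          nth_rw 1 [hFe]; rw [add_mul, smul_mul_assoc, one_mul]
        rw [e4, e3]; ring
      have e5 : η * fine n η = lamC L g (n + 1) ^ 2 • (ξ (n + 1) * fine n (ξ (n + 1))) := by
        rw [hη, fine_smul]; ext y; simp; ring
      rw [forceRem, force_of_lt hn, ← hFdef, ← hw, e2, hN.noise n, hN.chaos N n hn,
        lamC_succ g n, muC_succ r g n, e5]
      generalize ψ * w + η * (w - 1 - fine n η) + χ * (w - 1) = Z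
      rw [coarse_add _ _ _ Z, coarse_add _ _ _ (_ • (w - 1)), coarse_smul _ _ _ (w - 1), e1]
      simp only [hη, hχ, coarse_add, coarse_smul, coarse_one n.le_succ]
      ext x
      simp only [Pi.add_apply, Pi.sub_apply, Pi.smul_apply, smul_eq_mul, Pi.one_apply,
        Pi.zero_apply]
      ring
    rw [hstep, norm_smul, norm_pow, Real.norm_natCast]
    have hw43 := hfac.norm_le hF8
    -- In units of `(s ^ (n + 1)) ^ 3` the three terms are at most `7 / 36`, `41 / 8` and `15 / 16`.
    have hZ : ‖ψ * w + η * (w - 1 - fine n η) + χ * (w - 1)‖ ≤ 6.3 * (s ^ (n + 1)) ^ 3 := by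
      have t1 : ‖ψ * w‖ ≤ 7 * ((L : ℝ) ^ 2 * s ^ 3) * (s ^ (n + 1)) ^ 3 * (4 / 3) :=
        (norm_mul_le _ _).trans (by gcongr)
      have t2 : ‖η * (w - 1 - fine n η)‖ ≤ s ^ (n + 1) / 2 * (41 / 4 * (s ^ (n + 1)) ^ 2) :=
        (norm_mul_le _ _).trans (by gcongr)
      have t3 : ‖χ * (w - 1)‖ ≤ (s ^ (n + 1)) ^ 2 / 4 * (15 / 4 * s ^ (n + 1)) :=
        (norm_mul_le _ _).trans (by gcongr)
      have t4 := norm_add₃_le (a := ψ * w) (b := η * (w - 1 - fine n η)) (c := χ * (w - 1))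
      have t5 := pow_pos ha 3
      generalize s ^ (n + 1) = a at *
      nlinarith
    calc (L : ℝ) ^ 2 * ‖coarse L (n + 1) n
          (ψ * w + η * (w - 1 - fine n η) + χ * (w - 1))‖
        ≤ (L : ℝ) ^ 2 * (6.3 * (s ^ (n + 1)) ^ 3) := by
          gcongr
          exact (norm_coarse_le n.le_succ _).trans hZ
      _ = 6.3 * ((L : ℝ) ^ 2 * s ^ 3) * (s ^ n) ^ 3 := by ring
      _ ≤ _ := by gcongr; norm_num

end Force

/-! ### The limit of the effective forces and of the solutions -/

section Limit

variable {L : ℕ} [hL : Fact (Odd L)] {r g s : ℝ} {ξ : Traj L} {Ξ : ℕ → Traj L} {N : ℕ}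

namespace IsSmall

theorem norm_force_le_eighth (h : IsSmall r g s ξ Ξ) (hN : IsEnhancedNoise ξ Ξ) {n : ℕ}
    (hn : n < N) : ‖force r g ξ N (n + 1)‖ ≤ 1 / 8 := by
  have h1 := h.norm_force_le hn (h.norm_forceRem_le hN hn)
  have ha1 : s ^ (n + 1) ≤ 1 / 16 :=
    (pow_le_of_le_one h.pos.le (by linarith [h.le]) (by omega)).trans h.le
  linarith

theorem force_zero_ge (h : IsSmall r g s ξ Ξ) (hN : IsEnhancedNoise ξ Ξ) (x : UnitLat L 0) :
    5 / 48 ≤ force r g ξ N 0 x := by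
  have h1 := (norm_le_pi_norm _ x).trans (h.norm_forceRem_le hN (Nat.zero_le N))
  have h2 := (norm_le_pi_norm _ x).trans (h.noise 0)
  have h3 := (norm_le_pi_norm _ x).trans (h.chaos N 0 (Nat.zero_le N))
  have h4 := h.cube
  have h5 := h.one_le
  simp only [forceRem, muC, Pi.sub_apply, Pi.smul_apply, smul_eq_mul, Pi.one_apply,
    Real.norm_eq_abs, pow_zero, mul_zero, inv_one, Nat.cast_zero, zero_mul, sub_zero, one_mul,
    mul_one, one_pow] at h1 h2 h3
  have := abs_le.1 h1
  have := abs_le.1 h2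
  have := abs_le.1 h3
  linarith

theorem isForceFlow (h : IsSmall r g s ξ Ξ) (hN : IsEnhancedNoise ξ Ξ) (N : ℕ) :
    IsForceFlow N (force r g ξ N) (forceFactor r g ξ N) where
  ne_zero x := by linarith [h.force_zero_ge hN (N := N) x]
  isFactor n hn := isFactor_factor (h.norm_force_le_eighth hN hn)
  step n hn := force_of_lt hn

theorem norm_force_sub_le (h : IsSmall r g s ξ Ξ) (hN : IsEnhancedNoise ξ Ξ) {M n k : ℕ}
    (h1 : n + k ≤ N) (h2 : n + k ≤ M) :
    ‖force r g ξ N n - force r g ξ M n‖ ≤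
      (2 * (L : ℝ) ^ 2) ^ k * ‖force r g ξ N (n + k) - force r g ξ M (n + k)‖ := by
  induction k with
  | zero => simp
  | succ k ih =>
    refine (ih (by omega) (by omega)).trans ?_
    rw [pow_succ (2 * (L : ℝ) ^ 2), mul_assoc]
    gcongr
    rw [force_of_lt (N := N) (by omega), force_of_lt (N := M) (by omega), ← smul_sub, ← coarse_sub,
      norm_smul, norm_pow, Real.norm_natCast]
    have h3 := h.norm_force_le_eighth hN (N := N) (n := n + k) (by omega)
    have h4 := h.norm_force_le_eighth hN (N := M) (n := n + k) (by omega)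
    have h5 := (norm_coarse_le (n + k).le_succ _).trans
      ((isFactor_factor h3).norm_mul_sub_le (isFactor_factor h4) h3 h4)
    calc _ ≤ (L : ℝ) ^ 2 * (2 * ‖force r g ξ N (n + k + 1) - force r g ξ M (n + k + 1)‖) := by
          gcongr
      _ = _ := by rw [← add_assoc]; ring_nf

/-- The remainders at scale `n + k` are of order `s ^ (3 * (n + k))`, so that the expansion by `L²`
in each of the `k` steps down to scale `n` does not matter. -/
theorem cauchySeq_force (h : IsSmall r g s ξ Ξ) (hN : IsEnhancedNoise ξ Ξ) {Ξs : Traj L}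
    (hΞ : ∀ n, Tendsto (fun N => Ξ N n) atTop (𝓝 (Ξs n))) (n : ℕ) :
    CauchySeq fun N => force r g ξ N n := by
  rw [Metric.cauchySeq_iff]
  intro ε hε
  have hp := side_pos L
  obtain ⟨k, hk⟩ := exists_pow_lt_of_lt_one (half_pos hε) (by norm_num : (1 / 2 : ℝ) < 1)
  have hc : CauchySeq fun N => lamC L g (n + k) ^ 2 • Ξ N (n + k) :=
    ((hΞ (n + k)).const_smul _).cauchySeq
  obtain ⟨K, hK⟩ := Metric.cauchySeq_iff.1 hc (ε / 2 / (2 * (L : ℝ) ^ 2) ^ k) (by positivity)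
  refine ⟨max K (n + k), fun N hN1 M hM1 => ?_⟩
  have hN2 : n + k ≤ N := (le_max_right _ _).trans hN1
  have hM2 : n + k ≤ M := (le_max_right _ _).trans hM1
  have hd := hK N ((le_max_left _ _).trans hN1) M ((le_max_left _ _).trans hM1)
  rw [dist_eq_norm, lt_div_iff₀ (by positivity)] at hd
  rw [dist_eq_norm]
  have e : force r g ξ N (n + k) - force r g ξ M (n + k)
      = (lamC L g (n + k) ^ 2 • Ξ N (n + k) - lamC L g (n + k) ^ 2 • Ξ M (n + k))
        + forceRem r g ξ Ξ N (n + k) - forceRem r g ξ Ξ M (n + k) := by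
    simp only [forceRem]; abel
  have h3 := norm_sub_le ((lamC L g (n + k) ^ 2 • Ξ N (n + k) - lamC L g (n + k) ^ 2 • Ξ M (n + k))
        + forceRem r g ξ Ξ N (n + k)) (forceRem r g ξ Ξ M (n + k))
  have h4 := norm_add_le (lamC L g (n + k) ^ 2 • Ξ N (n + k) - lamC L g (n + k) ^ 2 • Ξ M (n + k))
    (forceRem r g ξ Ξ N (n + k))
  rw [← e] at h3
  have h5 := h.norm_forceRem_le hN hN2
  have h6 := h.norm_forceRem_le hN hM2
  have hs := h.pos
  have hc := h.cube
  have h7 : (2 * (L : ℝ) ^ 2) ^ k * (14 * ((L : ℝ) ^ 2 * s ^ 3) * (s ^ (n + k)) ^ 3)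
      ≤ (1 / 2) ^ k := by
    calc _ = 14 * ((L : ℝ) ^ 2 * s ^ 3) * (s ^ n) ^ 3 * (2 * ((L : ℝ) ^ 2 * s ^ 3)) ^ k := by
          rw [mul_pow 2, mul_pow 2, mul_pow ((L : ℝ) ^ 2)]; ring
      _ ≤ 1 * 1 * (1 / 2) ^ k := by
          gcongr
          · linarith
          · exact pow_le_one₀ (by positivity) (pow_le_one₀ hs.le (by linarith [h.le]))
          · linarith
      _ = _ := by ring
  refine (h.norm_force_sub_le hN hN2 hM2).trans_lt ?_
  calc _ ≤ (2 * (L : ℝ) ^ 2) ^ k *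
        (‖lamC L g (n + k) ^ 2 • Ξ N (n + k) - lamC L g (n + k) ^ 2 • Ξ M (n + k)‖
          + 14 * ((L : ℝ) ^ 2 * s ^ 3) * (s ^ (n + k)) ^ 3) := by
        gcongr
        linarith
    _ < ε := by
        rw [mul_add]
        linarith

end IsSmall

theorem continuous_lift {m n : ℕ} (h : n ≤ m) :
    Continuous (lift h : (UnitLat L n → ℝ) → UnitLat L m → ℝ) :=
  continuous_pi fun y => continuous_apply (parent h y)

/-- Convergence of the effective forces and factors to a flow on all scales. -/
theorem IsSmall.exists_limit (h : IsSmall r g s ξ Ξ) (hN : IsEnhancedNoise ξ Ξ) {Ξs : Traj L}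
    (hΞ : ∀ n, Tendsto (fun N => Ξ N n) atTop (𝓝 (Ξs n))) :
    ∃ Fs ws : Traj L, (∀ N, IsForceFlow N Fs ws) ∧
      (∀ n, Tendsto (fun N => force r g ξ N n) atTop (𝓝 (Fs n))) ∧
      ∀ n, Tendsto (fun N => sol (force r g ξ N) (forceFactor r g ξ N) n) atTop
        (𝓝 (sol Fs ws n)) := by
  choose Fs hFs using fun n => cauchySeq_tendsto_of_complete (h.cauchySeq_force hN hΞ n)
  let ws : Traj L := fun n => match n with
    | 0 => 1
    | n + 1 => factor n (Fs (n + 1))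
  have hF8 : ∀ n, ‖Fs (n + 1)‖ ≤ 1 / 8 := fun n =>
    le_of_tendsto (hFs (n + 1)).norm
      ((eventually_gt_atTop n).mono fun N hn => h.norm_force_le_eighth hN hn)
  have hws : ∀ n, Tendsto (fun N => forceFactor r g ξ N (n + 1)) atTop (𝓝 (ws (n + 1))) := by
    intro n
    rw [tendsto_iff_norm_sub_tendsto_zero]
    have h0 := (tendsto_iff_norm_sub_tendsto_zero.1 (hFs (n + 1))).const_mul 4
    rw [mul_zero] at h0
    refine tendsto_of_tendsto_of_tendsto_of_le_of_le' tendsto_const_nhds h0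
      (Eventually.of_forall fun _ => norm_nonneg _) ((eventually_gt_atTop n).mono fun N hn => ?_)
    have h8 := h.norm_force_le_eighth hN hn
    exact (isFactor_factor h8).norm_sub_le (isFactor_factor (hF8 n)) h8 (hF8 n)
  have h0 : ∀ x, 5 / 48 ≤ Fs 0 x := fun x =>
    ge_of_tendsto (tendsto_pi_nhds.1 (hFs 0) x)
      (Eventually.of_forall fun N => h.force_zero_ge hN (N := N) x)
  have hflow : ∀ N, IsForceFlow N Fs ws := fun N =>
    { ne_zero := fun x => by linarith [h0 x]
      isFactor := fun n _ => isFactor_factor (hF8 n)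
      step := fun n _ => by
        have h1 : Tendsto (fun N => force r g ξ N n) atTop
            (𝓝 ((L : ℝ) ^ 2 • coarse L (n + 1) n (Fs (n + 1) * ws (n + 1)))) := by
          refine Tendsto.congr' ((eventually_gt_atTop n).mono fun N hn => (force_of_lt hn).symm) ?_
          exact (((continuous_coarse (n + 1) n).tendsto _).comp
            ((hFs (n + 1)).mul (hws n))).const_smul _
        exact tendsto_nhds_unique (hFs n) h1 }
  refine ⟨Fs, ws, hflow, hFs, fun n => ?_⟩
  induction n with
  | zero =>
    refine Tendsto.neg (tendsto_pi_nhds.2 fun x => ?_)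
    exact (tendsto_pi_nhds.1 (hFs 0) x).inv₀ (by linarith [h0 x])
  | succ n ih =>
    exact ((hws n).mul (((continuous_lift n.le_succ).tendsto _).comp ih)).const_smul _

/-! ### The bare equation -/

theorem negLapTorus_eq (N : ℕ) (u : UnitLat L N → ℝ) (z : UnitLat L N) :
    negLapTorus L N u z = (L : ℝ) ^ (2 * N) * negLap L N u z := by
  have hp := side_pos L
  rw [negLapTorus, negLap, Finset.mul_sum]
  refine Finset.sum_nbij' (fun n => N + 1 - n) (fun n => N + 1 - n) ?_ ?_ ?_ ?_ ?_
  · intro n hn; simp only [Finset.mem_Icc] at hn ⊢; omega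
  · intro n hn; simp only [Finset.mem_Icc] at hn ⊢; omega
  · intro n hn; simp only [Finset.mem_Icc] at hn ⊢; omega
  · intro n hn; simp only [Finset.mem_Icc] at hn ⊢; omega
  · intro n hn
    rw [Finset.mem_Icc] at hn
    obtain ⟨k, rfl⟩ := Nat.exists_eq_add_of_le hn.2
    have e1 : n + k + 1 - n = k + 1 := by omega
    have e2 : n + k - n = k := by omega
    rw [e1, e2, fluct, Nat.add_sub_cancel, ← mul_assoc]
    congr 1
    rw [mul_add, pow_add]
    field_simp

theorem isBareSolution_iff (N : ℕ) (u : UnitLat L N → ℝ) :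
    IsBareSolution L r g N ((L : ℝ) ^ N • ξ N) u ↔
      negLap L N (unitSol L N u) = force r g ξ N N * unitSol L N u + fun _ => gamC L N := by
  have hp := side_pos L
  have hu : unitSol L N u = (L : ℝ) ^ N • u := rfl
  rw [IsBareSolution, hu, negLap_smul, force_self, funext_iff]
  refine forall_congr' fun z => ?_
  rw [negLapTorus_eq]
  simp only [Pi.add_apply, Pi.smul_apply, Pi.mul_apply, smul_eq_mul, Pi.one_apply, lamC, gamC, muC]
  have e : (L : ℝ) ^ (2 * N) = (L : ℝ) ^ N * (L : ℝ) ^ N := by rw [two_mul, pow_add]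
  constructor
  · intro h
    refine mul_left_cancel₀ (pow_pos hp N).ne' ?_
    rw [← mul_assoc, ← e, h, e]
    field_simp
  · intro h
    rw [e, mul_assoc, h, e]
    field_simp

/-- The conclusion for one realisation of the noise that is small, together with its second chaos,
and whose second chaos converges. -/
theorem IsSmall.exists_solution_and_limits (h : IsSmall r g s ξ Ξ) (hN : IsEnhancedNoise ξ Ξ)
    (hg : g ≠ 0) {Ξs : Traj L} (hΞ : ∀ n, Tendsto (fun N => Ξ N n) atTop (𝓝 (Ξs n))) :
    ∃ (u : (N : ℕ) → UnitLat L N → ℝ) (Ψ R : ℕ → Traj L),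
      (∀ (N : ℕ) (u' : UnitLat L N → ℝ),
        IsBareSolution L r g N ((L : ℝ) ^ N • ξ N) u' ↔ u' = u N) ∧
      (∀ (N : ℕ) (Ψ' R' : Traj L),
        IsRemainderFlow L r g N ξ (Ξ N) Ψ' R' ↔ Ψ' = Ψ N ∧ R' = R N) ∧
      ∃ vs Ψs : Traj L, ∀ n : ℕ,
        Tendsto (fun N => coarseSol L N n (u N)) atTop (𝓝 (vs n)) ∧
        Tendsto (fun N => Ψ N n) atTop (𝓝 (Ψs n)) ∧
        (∀ x : UnitLat L n,
          negLap L n (vs n) x =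
            (lamC L g n * ξ n x + lamC L g n ^ 2 * Ξs n x
              + lamC L g n ^ 3 * Ψs n x + muC L r g n) * vs n x + gamC L n) ∧
        ∀ m : ℕ, n < m → ∀ x : UnitLat L n,
          vs n x = ((L : ℝ) ^ (m - n))⁻¹ * coarse L m n (vs m) x := by
  have hp := side_pos L
  have hl : ∀ n, lamC L g n ≠ 0 := fun n => mul_ne_zero (by positivity) hg
  obtain ⟨Fs, ws, hflow, hFs, hsol⟩ := h.exists_limit hN hΞ
  have hF8 : ∀ N n, n < N → ‖force r g ξ N (n + 1)‖ ≤ 1 / 8 :=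
    fun N n hn => h.norm_force_le_eighth hN hn
  set v : ℕ → Traj L := fun N => sol (force r g ξ N) (forceFactor r g ξ N) with hv
  have hunit : ∀ N, unitSol L N (((L : ℝ) ^ N)⁻¹ • v N N) = v N N := by
    intro N
    ext x
    simp only [unitSol, Pi.smul_apply, smul_eq_mul]
    field_simp
  refine ⟨fun N => ((L : ℝ) ^ N)⁻¹ • v N N, flowPsi r g ξ Ξ, flowRem r g ξ, fun N u' => ?_,
    fun N Ψ' R' => isRemainderFlow_iff hN hl h.mass_ne_one (hF8 N) Ψ' R',
    sol Fs ws, fun n => (lamC L g n ^ 3)⁻¹ •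
      (Fs n - lamC L g n • ξ n - lamC L g n ^ 2 • Ξs n - muC L r g n • 1), fun n => ⟨?_, ?_, ?_, ?_⟩⟩
  · rw [isBareSolution_iff]
    constructor
    · intro h1
      have h2 := (h.isForceFlow hN N).eq_sol (hF8 N) le_rfl h1
      have h3 : (L : ℝ) ^ N • u' = v N N := h2
      rw [eq_inv_smul_iff₀ (by positivity), h3]
    · rintro rfl
      rw [hunit]
      exact (h.isForceFlow hN N).negLap_sol le_rfl
  · refine Tendsto.congr' ((eventually_ge_atTop n).mono fun N hn => ?_) (hsol n)
    ext x
    simp only [coarseSol, hunit]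
    rw [hv, (h.isForceFlow hN N).coarse_sol hn le_rfl, Pi.smul_apply, smul_eq_mul, ← mul_assoc,
      inv_mul_cancel₀ (by positivity), one_mul]
  · refine Tendsto.congr' (f₁ := fun N => (lamC L g n ^ 3)⁻¹ • forceRem r g ξ Ξ N n)
      ((eventually_gt_atTop n).mono fun N hn => ?_) ?_
    · dsimp only
      rw [flowPsi, if_neg (not_le.2 hn)]
    · simp only [forceRem]
      exact ((((hFs n).sub_const _).sub ((hΞ n).const_smul _)).sub_const _).const_smul _
  · intro x
    rw [(hflow n).negLap_sol le_rfl]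
    have := hl n
    simp only [Pi.add_apply, Pi.mul_apply, Pi.smul_apply, Pi.sub_apply, smul_eq_mul, Pi.one_apply]
    field_simp
    ring
  · intro m hm x
    rw [(hflow m).coarse_sol hm.le le_rfl, Pi.smul_apply, smul_eq_mul, ← mul_assoc,
      inv_mul_cancel₀ (by positivity), one_mul]

end Limit

/-! ### The noise on the cells of the torus -/

section Cells

variable {L : ℕ} [hL : Fact (Odd L)]

omit hL in
theorem two_mul_abs_add_one_le {n : ℕ} (x : UnitLat L n) (i : Fin 2) :
    2 * |(x.1 i : ℝ)| + 1 ≤ (L : ℝ) ^ n := by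
  have h : 2 * |x.1 i| + 1 ≤ (L : ℤ) ^ n := x.2 i
  exact_mod_cast h

theorem cell_subset_cell_parent {m n : ℕ} (h : n ≤ m) (y : UnitLat L m) :
    cell L m y ⊆ cell L n (parent h y) := by
  have hp := side_pos L
  refine Set.pi_mono fun i _ => ?_
  have hb : 2 * |y.1 i - (L : ℤ) ^ (m - n) * (parent h y).1 i| + 1 ≤ (L : ℤ) ^ (m - n) :=
    inBlock_parent h y i
  have hb' : 2 * |(y.1 i : ℝ) - (L : ℝ) ^ (m - n) * (parent h y).1 i| + 1 ≤ (L : ℝ) ^ (m - n) := by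
    exact_mod_cast hb
  have hm : (L : ℝ) ^ m = (L : ℝ) ^ (m - n) * (L : ℝ) ^ n := by
    rw [← pow_add, Nat.sub_add_cancel h]
  generalize ((parent h y).1 i : ℝ) = a at *
  generalize (y.1 i : ℝ) = b at *
  have hK : 0 < (L : ℝ) ^ (m - n) := by positivity
  have hM : 0 < (L : ℝ) ^ n := by positivity
  rw [hm]
  generalize (L : ℝ) ^ (m - n) = K at *
  generalize (L : ℝ) ^ n = M at *
  have h1 := abs_le.1 (show |b - K * a| ≤ (K - 1) / 2 by linarith)
  refine Set.Ico_subset_Ico ?_ ?_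
  · rw [div_le_div_iff₀ hM (by positivity)]
    nlinarith
  · rw [div_le_div_iff₀ (by positivity) hM]
    nlinarith

theorem disjoint_cell {n : ℕ} {x y : UnitLat L n} (h : x ≠ y) :
    Disjoint (cell L n x) (cell L n y) := by
  have hp : 0 < (L : ℝ) ^ n := pow_pos (side_pos L) n
  rw [Set.disjoint_left]
  intro t hx hy
  refine h (Subtype.ext (funext fun i => ?_))
  have h1 := hx i (Set.mem_univ i)
  have h2 := hy i (Set.mem_univ i)
  rw [Set.mem_Ico, div_le_iff₀ hp, lt_div_iff₀ hp] at h1 h2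
  have h3 : (x.1 i : ℝ) < y.1 i + 1 := by linarith
  have h4 : (y.1 i : ℝ) < x.1 i + 1 := by linarith
  have h5 : x.1 i < y.1 i + 1 := by exact_mod_cast h3
  have h6 : y.1 i < x.1 i + 1 := by exact_mod_cast h4
  omega

theorem torusMeasure_real_cell {n : ℕ} (x : UnitLat L n) :
    torusMeasure.real (cell L n x) = ((L : ℝ) ^ (2 * n))⁻¹ := by
  have hp : 0 < (L : ℝ) ^ n := pow_pos (side_pos L) n
  have hsub : cell L n x ⊆ Set.pi Set.univ fun _ => Set.Ico (-1 / 2 : ℝ) (1 / 2) := by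
    refine Set.pi_mono fun i _ => Set.Ico_subset_Ico ?_ ?_
    · have h1 := two_mul_abs_add_one_le x i
      have h2 := neg_abs_le (x.1 i : ℝ)
      rw [le_div_iff₀ hp]
      linarith
    · have h1 := two_mul_abs_add_one_le x i
      have h2 := le_abs_self (x.1 i : ℝ)
      rw [div_le_iff₀ hp]
      linarith
  rw [measureReal_def, torusMeasure, Measure.restrict_eq_self _ hsub, cell, volume_pi_pi,
    ENNReal.toReal_prod]
  have : ∀ i : Fin 2, (volume (Set.Ico (((x.1 i : ℝ) - 1 / 2) / (L : ℝ) ^ n)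
      (((x.1 i : ℝ) + 1 / 2) / (L : ℝ) ^ n))).toReal = ((L : ℝ) ^ n)⁻¹ := by
    intro i
    rw [Real.volume_Ico, ENNReal.toReal_ofReal]
    · field_simp; ring
    · rw [← sub_div]; refine div_nonneg ?_ hp.le; linarith
  simp only [this, Finset.prod_const, Finset.card_univ, Fintype.card_fin]
  rw [inv_pow, ← pow_mul, mul_comm]

theorem torusMeasure_real_inter {m n : ℕ} (h : n ≤ m) (x : UnitLat L n) (y : UnitLat L m) :
    torusMeasure.real (cell L n x ∩ cell L m y) =
      if parent h y = x then ((L : ℝ) ^ (2 * m))⁻¹ else 0 := by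
  split_ifs with hxy
  · rw [Set.inter_eq_self_of_subset_right (hxy ▸ cell_subset_cell_parent h y),
      torusMeasure_real_cell]
  · have : cell L n x ∩ cell L m y = ∅ := Set.disjoint_iff_inter_eq_empty.1
      ((disjoint_cell (Ne.symm hxy)).mono_right (cell_subset_cell_parent h y))
    rw [this, measureReal_empty]

end Cells

section WhiteNoise

variable {L : ℕ} [hL : Fact (Odd L)] {Ω : Type*} [MeasurableSpace Ω] {P : Measure Ω}
  {W : Lp ℝ 2 torusMeasure → Ω → ℝ}

theorem integral_unitNoise_mul (hW : IsWhiteNoise P W) {m n : ℕ} (h : n ≤ m) (x : UnitLat L n)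
    (y : UnitLat L m) :
    ∫ ω, unitNoise L W n x ω * unitNoise L W m y ω ∂P =
      if parent h y = x then (L : ℝ) ^ n * ((L : ℝ) ^ m)⁻¹ else 0 := by
  have hp := side_pos L
  have e : ∀ ω, unitNoise L W n x ω * unitNoise L W m y ω = ((L : ℝ) ^ n * (L : ℝ) ^ m) *
      (W (indicatorConstLp 2 (measurableSet_cell L n x) (measure_ne_top torusMeasure _) (1 : ℝ)) ω *
      W (indicatorConstLp 2 (measurableSet_cell L m y) (measure_ne_top torusMeasure _) (1 : ℝ)) ω) := by
    intro ω
    simp only [unitNoise, torusNoise, two_mul, pow_add]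
    field_simp
  simp only [e]
  rw [integral_const_mul, hW.cov, L2.real_inner_indicatorConstLp_one_indicatorConstLp_one,
    torusMeasure_real_inter h]
  split_ifs
  · rw [two_mul, pow_add]
    field_simp
  · simp

theorem integral_unitNoise_mul_same (hW : IsWhiteNoise P W) {n : ℕ} (x y : UnitLat L n) :
    ∫ ω, unitNoise L W n x ω * unitNoise L W n y ω ∂P = if y = x then 1 else 0 := by
  have hp := pow_pos (side_pos L) n
  rw [integral_unitNoise_mul hW le_rfl, parent_self, mul_inv_cancel₀ hp.ne']

omit hL in
theorem hasGaussianLaw_unitNoise (hW : IsWhiteNoise P W) {n : ℕ} (x : UnitLat L n) :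
    HasGaussianLaw (unitNoise L W n x) P :=
  ((hW.gaussian.hasGaussianLaw_eval _).fun_smul ((L : ℝ) ^ (2 * n))).fun_smul ((L : ℝ) ^ n)⁻¹

omit hL in
theorem memLp_unitNoise (hW : IsWhiteNoise P W) {n : ℕ} (x : UnitLat L n) :
    MemLp (unitNoise L W n x) 2 P := (hasGaussianLaw_unitNoise hW x).memLp_two

omit hL in
theorem integral_unitNoise (hW : IsWhiteNoise P W) {n : ℕ} (x : UnitLat L n) :
    ∫ ω, unitNoise L W n x ω ∂P = 0 := by
  simp only [unitNoise, torusNoise, integral_const_mul, hW.mean, mul_zero]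

theorem integral_sub_smul_sum_sq {ι : Type*} (s : Finset ι) {a : Ω → ℝ} {b : ι → Ω → ℝ} (c : ℝ)
    (ha : MemLp a 2 P) (hb : ∀ i, MemLp (b i) 2 P) :
    ∫ ω, (a ω - c * ∑ i ∈ s, b i ω) ^ 2 ∂P = ∫ ω, a ω * a ω ∂P
      - 2 * c * ∑ i ∈ s, ∫ ω, a ω * b i ω ∂P
      + c ^ 2 * ∑ i ∈ s, ∑ j ∈ s, ∫ ω, b i ω * b j ω ∂P := by
  have e : ∀ ω, (a ω - c * ∑ i ∈ s, b i ω) ^ 2 = a ω * a ω - 2 * c * ∑ i ∈ s, a ω * b i ω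
      + c ^ 2 * ∑ i ∈ s, ∑ j ∈ s, b i ω * b j ω := by
    intro ω
    rw [← Finset.mul_sum, ← Finset.sum_mul_sum]
    ring
  simp only [e]
  have h1 : Integrable (fun ω => a ω * a ω) P := ha.integrable_mul ha
  have h2 : ∀ i, Integrable (fun ω => a ω * b i ω) P := fun i => ha.integrable_mul (hb i)
  have h3 : ∀ i j, Integrable (fun ω => b i ω * b j ω) P := fun i j => (hb i).integrable_mul (hb j)
  have h4 : ∀ i, Integrable (fun ω => ∑ j ∈ s, b i ω * b j ω) P :=
    fun i => integrable_finsetSum _ fun j _ => h3 i j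
  have h5 : Integrable (fun ω => 2 * c * ∑ i ∈ s, a ω * b i ω) P :=
    (integrable_finsetSum _ fun i _ => h2 i).const_mul _
  have h6 : Integrable (fun ω => c ^ 2 * ∑ i ∈ s, ∑ j ∈ s, b i ω * b j ω) P :=
    (integrable_finsetSum _ fun i _ => h4 i).const_mul _
  have h7 : Integrable (fun ω => a ω * a ω - 2 * c * ∑ i ∈ s, a ω * b i ω) P := h1.sub h5
  rw [integral_add h7 h6, integral_sub h1 h5,
    integral_const_mul, integral_const_mul, integral_finsetSum _ fun i _ => h2 i,
    integral_finsetSum _ fun i _ => h4 i]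
  simp only [integral_finsetSum _ fun j _ => h3 _ j]

/-- The noise on a coarse cell is the sum of the noise on the finer cells in it, since the
difference has second moment zero. -/
theorem unitNoise_ae_eq (hW : IsWhiteNoise P W) (n : ℕ) (x : UnitLat L n) :
    ∀ᵐ ω ∂P, unitNoise L W n x ω =
      L * coarse L (n + 1) n (fun y => unitNoise L W (n + 1) y ω) x := by
  have hp := side_pos L
  have h0 := integral_sub_smul_sum_sq (P := P) (Finset.univ.filter fun y => parent n.le_succ y = x)
    (L : ℝ)⁻¹ (memLp_unitNoise hW x) (fun y : UnitLat L (n + 1) => memLp_unitNoise hW y)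
  have e1 : ∑ y with parent n.le_succ y = x,
      ∫ ω, unitNoise L W n x ω * unitNoise L W (n + 1) y ω ∂P = (L : ℝ) := by
    rw [Finset.sum_congr rfl fun y hy => by
      rw [integral_unitNoise_mul hW n.le_succ, if_pos (Finset.mem_filter.1 hy).2]]
    rw [Finset.sum_const, card_block, nsmul_eq_mul]
    simp only [Nat.succ_eq_add_one, Nat.add_sub_cancel_left]
    push_cast
    field_simp
    ring
  have e2 : ∑ y with parent n.le_succ y = x, ∑ y' with parent n.le_succ y' = x,
      ∫ ω, unitNoise L W (n + 1) y ω * unitNoise L W (n + 1) y' ω ∂P = (L : ℝ) ^ 2 := by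
    simp only [integral_unitNoise_mul_same hW]
    rw [Finset.sum_congr rfl fun y hy => by rw [Finset.sum_ite_eq', if_pos hy]]
    rw [Finset.sum_const, card_block, nsmul_eq_mul]
    simp
  rw [e1, e2, integral_unitNoise_mul_same hW, if_pos rfl] at h0
  have h1 : ∫ ω, (unitNoise L W n x ω - (L : ℝ)⁻¹ * ∑ y with parent n.le_succ y = x,
      unitNoise L W (n + 1) y ω) ^ 2 ∂P = 0 := by
    rw [h0]; field_simp; ring
  have hmem : MemLp (fun ω => unitNoise L W n x ω - (L : ℝ)⁻¹ * ∑ y with parent n.le_succ y = x,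
      unitNoise L W (n + 1) y ω) 2 P :=
    (memLp_unitNoise hW x).sub ((memLp_finsetSum _ fun y _ => memLp_unitNoise hW y).const_mul _)
  rw [integral_eq_zero_iff_of_nonneg (fun ω => sq_nonneg _) hmem.integrable_sq] at h1
  filter_upwards [h1] with ω hω
  have h2 := sub_eq_zero.1 (pow_eq_zero_iff two_ne_zero |>.1 hω)
  rw [h2, coarse_eq n.le_succ]
  simp only [Nat.succ_eq_add_one, Nat.add_sub_cancel_left, mul_one]
  field_simp

end WhiteNoise

/-! ### The second chaos -/

section Chaos

variable {L : ℕ} [hL : Fact (Odd L)]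

/-- The fluctuation propagator, indexed by the scale `i = N - j` of the averages in `P_j`. -/
theorem fluctProp_eq {N k : ℕ} (hk : k ≤ N) (f : UnitLat L N → ℝ) :
    fluctProp L N k f = ∑ i ∈ (Finset.Ico (N - k) N).attach, (L : ℝ) ^ (2 * (N - (i + 1))) •
      (lift (Finset.mem_Ico.1 i.2).2 (coarse L N (i + 1) f)
        - lift (Finset.mem_Ico.1 i.2).2.le (coarse L N i f)) := by
  ext x
  rw [fluctProp, Finset.sum_apply]
  symm
  refine Finset.sum_bij' (fun i _ => N - i.1) (fun j hj => ⟨N - j, by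
    simp only [Finset.mem_Icc, Finset.mem_Ico] at hj ⊢; omega⟩) ?_ ?_ ?_ ?_ ?_
  · intro i _
    have := i.2
    simp only [Finset.mem_Icc, Finset.mem_Ico] at this ⊢
    omega
  · intro j hj
    exact Finset.mem_attach _ _
  · intro i _
    have := i.2
    simp only [Finset.mem_Ico] at this
    ext
    dsimp only
    omega
  · intro j hj
    simp only [Finset.mem_Icc] at hj
    dsimp only
    omega
  · intro i _
    have := i.2
    simp only [Finset.mem_Ico] at this
    rw [fluct_eq (i := i) (j := i + 1) (by omega) (by omega)]
    rw [show N - (i.1 + 1) = N - i.1 - 1 by omega]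
    rfl

/-- The averages over the blocks of side length `L ^ (i - n)` of the square of the noise on `Λ^i`,
for `n ≤ i`. -/
def sqAvg (ξ : Traj L) (i n : ℕ) : UnitLat L n → ℝ := coarse L i n (ξ i * ξ i)

variable {ξ : Traj L}

theorem noise_eq_coarse (hξ : ∀ n, ξ n = (L : ℝ) • coarse L (n + 1) n (ξ (n + 1))) {m n : ℕ}
    (h : n ≤ m) : ξ n = (L : ℝ) ^ (m - n) • coarse L m n (ξ m) := by
  induction m, h using Nat.le_induction with
  | base => simp [coarse_self]
  | succ m h ih =>
    rw [ih, hξ m, coarse_smul, coarse_coarse m.le_succ h, smul_smul, ← pow_succ, Nat.succ_sub h]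

theorem coarse_noise_mul_lift_coarse (hξ : ∀ n, ξ n = (L : ℝ) • coarse L (n + 1) n (ξ (n + 1)))
    {m i n : ℕ} (h : i ≤ m) (h' : n ≤ i) :
    coarse L m n (ξ m * lift h (coarse L m i (ξ m)))
      = ((L : ℝ) ^ (2 * (m - i)))⁻¹ • sqAvg ξ i n := by
  have hp := side_pos L
  rw [← coarse_coarse h h', coarse_mul_lift, sqAvg, noise_eq_coarse hξ h, ← coarse_smul]
  congr 1
  ext x
  simp only [Pi.mul_apply, Pi.smul_apply, smul_eq_mul, two_mul, pow_add]
  field_simp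

/-- The quadratic form defining the second chaos is a telescoping expression in the averages of the
squared noise. -/
theorem coarse_noise_mul_fluctProp (hξ : ∀ n, ξ n = (L : ℝ) • coarse L (n + 1) n (ξ (n + 1)))
    {N n : ℕ} (h : n ≤ N) :
    coarse L N n (ξ N * fluctProp L N (N - n) (ξ N)) =
      ∑ i ∈ Finset.Ico n N, (sqAvg ξ (i + 1) n - ((L : ℝ) ^ 2)⁻¹ • sqAvg ξ i n) := by
  have hp := side_pos L
  rw [fluctProp_eq (Nat.sub_le N n), Finset.mul_sum, coarse_sum, Nat.sub_sub_self h,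
    ← Finset.sum_attach (Finset.Ico n N)]
  refine Finset.sum_congr rfl fun i _ => ?_
  have hi := Finset.mem_Ico.1 i.2
  rw [mul_smul_comm, coarse_smul, mul_sub, coarse_sub, coarse_noise_mul_lift_coarse hξ,
    coarse_noise_mul_lift_coarse hξ _ hi.1, smul_sub, smul_smul, smul_smul,
    mul_inv_cancel₀ (by positivity), one_smul]
  · congr 2
    rw [show 2 * (N - i.1) = 2 * (N - (i.1 + 1)) + 2 by omega, pow_add]
    field_simp
  · omega

variable {Ω : Type*} [MeasurableSpace Ω] {P : Measure Ω}
  {W : Lp ℝ 2 torusMeasure → Ω → ℝ}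

theorem integral_unitNoise_mul_lift_coarse (hW : IsWhiteNoise P W) {N i : ℕ} (h : i ≤ N)
    (y : UnitLat L N) :
    Integrable (fun ω => unitNoise L W N y ω *
        lift h (coarse L N i fun z => unitNoise L W N z ω) y) P ∧
      ∫ ω, unitNoise L W N y ω * lift h (coarse L N i fun z => unitNoise L W N z ω) y ∂P
        = ((L : ℝ) ^ (2 * (N - i)))⁻¹ := by
  have e : ∀ ω, unitNoise L W N y ω * lift h (coarse L N i fun z => unitNoise L W N z ω) y
      = ((L : ℝ) ^ (2 * (N - i)))⁻¹ * ∑ z with parent h z = parent h y,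
        unitNoise L W N y ω * unitNoise L W N z ω := by
    intro ω
    rw [lift, coarse_eq h, ← Finset.mul_sum]
    ring
  have hint : ∀ z, Integrable (fun ω => unitNoise L W N y ω * unitNoise L W N z ω) P :=
    fun z => (memLp_unitNoise hW y).integrable_mul (memLp_unitNoise hW z)
  simp only [e]
  refine ⟨(integrable_finsetSum _ fun z _ => hint z).const_mul _, ?_⟩
  rw [integral_const_mul, integral_finsetSum _ fun z _ => hint z]
  simp only [integral_unitNoise_mul_same hW]
  rw [Finset.sum_ite_eq', if_pos (by simp), mul_one]

theorem integral_unitNoise_mul_fluctProp (hW : IsWhiteNoise P W) {N k : ℕ} (hk : k ≤ N)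
    (y : UnitLat L N) :
    ∫ ω, unitNoise L W N y ω * fluctProp L N k (fun z => unitNoise L W N z ω) y ∂P
      = k * (1 - ((L : ℝ) ^ 2)⁻¹) := by
  have hp := side_pos L
  have e : ∀ ω, unitNoise L W N y ω * fluctProp L N k (fun z => unitNoise L W N z ω) y
      = ∑ i ∈ (Finset.Ico (N - k) N).attach, (L : ℝ) ^ (2 * (N - (i + 1))) *
        (unitNoise L W N y ω * lift (Finset.mem_Ico.1 i.2).2
            (coarse L N (i + 1) fun z => unitNoise L W N z ω) y
          - unitNoise L W N y ω * lift (Finset.mem_Ico.1 i.2).2.le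
            (coarse L N i fun z => unitNoise L W N z ω) y) := by
    intro ω
    rw [fluctProp_eq hk, Finset.sum_apply, Finset.mul_sum]
    refine Finset.sum_congr rfl fun i _ => ?_
    simp only [Pi.smul_apply, Pi.sub_apply, smul_eq_mul]
    ring
  simp only [e]
  have hint : ∀ i ∈ (Finset.Ico (N - k) N).attach, Integrable (fun ω =>
      (L : ℝ) ^ (2 * (N - (i.1 + 1))) *
        (unitNoise L W N y ω * lift (Finset.mem_Ico.1 i.2).2
            (coarse L N (i + 1) fun z => unitNoise L W N z ω) y
          - unitNoise L W N y ω * lift (Finset.mem_Ico.1 i.2).2.le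
            (coarse L N i fun z => unitNoise L W N z ω) y)) P := fun i _ =>
    ((integral_unitNoise_mul_lift_coarse hW _ y).1.sub
      (integral_unitNoise_mul_lift_coarse hW _ y).1).const_mul _
  rw [integral_finsetSum _ hint]
  rw [Finset.sum_congr rfl (g := fun _ => 1 - ((L : ℝ) ^ 2)⁻¹)]
  · rw [Finset.sum_const, Finset.card_attach, Nat.card_Ico, Nat.sub_sub_self hk, nsmul_eq_mul]
  · intro i _
    have hi := Finset.mem_Ico.1 i.2
    rw [integral_const_mul, integral_sub (integral_unitNoise_mul_lift_coarse hW _ y).1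
      (integral_unitNoise_mul_lift_coarse hW _ y).1, (integral_unitNoise_mul_lift_coarse hW _ y).2,
      (integral_unitNoise_mul_lift_coarse hW _ y).2]
    rw [show 2 * (N - i.1) = 2 * (N - (i.1 + 1)) + 2 by omega, pow_add]
    field_simp

/-- The second chaos as a sum over scales of centred averages of the squared noise. -/
theorem secondChaos_eq (hW : IsWhiteNoise P W) {ω : Ω}
    (hξ : ∀ n, (fun x => unitNoise L W n x ω) =
      (L : ℝ) • coarse L (n + 1) n fun y => unitNoise L W (n + 1) y ω)
    {N n : ℕ} (h : n ≤ N) :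
    (fun x => secondChaos P L W N n x ω) = ∑ i ∈ Finset.Ico n N,
      ((sqAvg (fun m x => unitNoise L W m x ω) (i + 1) n - 1)
        - ((L : ℝ) ^ 2)⁻¹ • (sqAvg (fun m x => unitNoise L W m x ω) i n - 1)) := by
  have e1 : (fun x => secondChaos P L W N n x ω) = coarse L N n
      ((fun y => unitNoise L W N y ω) * fluctProp L N (N - n) (fun y => unitNoise L W N y ω)
        - ((N - n : ℕ) * (1 - ((L : ℝ) ^ 2)⁻¹)) • 1) := by
    ext x
    rw [secondChaos, if_pos h]
    congr 1
    ext y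
    simp only [wick, integral_unitNoise_mul_fluctProp hW (Nat.sub_le N n), Pi.sub_apply,
      Pi.mul_apply, Pi.smul_apply, Pi.one_apply, smul_eq_mul, mul_one]
  rw [e1, coarse_sub, coarse_smul, coarse_one h,
    coarse_noise_mul_fluctProp (ξ := fun m x => unitNoise L W m x ω) hξ h, sub_eq_iff_eq_add,
    ← Nat.card_Ico, mul_smul, Nat.cast_smul_eq_nsmul, ← Finset.sum_const, ← Finset.sum_add_distrib]
  refine Finset.sum_congr rfl fun i _ => ?_
  ext x
  simp
  ring

theorem isEnhancedNoise_unitNoise (hW : IsWhiteNoise P W) {ω : Ω}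
    (hξ : ∀ n, (fun x => unitNoise L W n x ω) =
      (L : ℝ) • coarse L (n + 1) n fun y => unitNoise L W (n + 1) y ω) :
    IsEnhancedNoise (fun n x => unitNoise L W n x ω) (fun N n x => secondChaos P L W N n x ω) where
  noise := hξ
  chaos_self N := by
    rw [secondChaos_eq hW hξ le_rfl, Finset.Ico_self, Finset.sum_empty]
  chaos N n hn := by
    rw [secondChaos_eq hW hξ hn.le, secondChaos_eq hW hξ (Nat.succ_le_of_lt hn), coarse_sum,
      Finset.sum_eq_sum_Ico_succ_bot hn, add_comm _ (Finset.sum _ _), add_sub_assoc]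
    congr 1
    · refine Finset.sum_congr rfl fun i hi => ?_
      have hi' := Finset.mem_Ico.1 hi
      rw [coarse_sub, coarse_smul, coarse_sub, coarse_sub, coarse_one n.le_succ, sqAvg, sqAvg,
        sqAvg, sqAvg, coarse_coarse (by omega) n.le_succ, coarse_coarse (by omega) n.le_succ]
    · have h1 := coarse_noise_mul_lift_coarse (ξ := fun m x => unitNoise L W m x ω) hξ n.le_succ
        le_rfl
      rw [fine, mul_sub, coarse_sub, h1, sqAvg]
      ext x
      simp only [Pi.sub_apply, Pi.smul_apply, smul_eq_mul, Pi.one_apply, Nat.succ_eq_add_one,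
        Nat.add_sub_cancel_left, mul_one]
      ring

/-! ### Almost sure convergence of the second chaos -/

/-- The variance of the square of a standard Gaussian variable. -/
def sqVar : ℝ := Var[fun t : ℝ => t ^ 2; gaussianReal 0 1]

theorem map_unitNoise (hW : IsWhiteNoise P W) {n : ℕ} (x : UnitLat L n) :
    P.map (unitNoise L W n x) = gaussianReal 0 1 := by
  have h := hasGaussianLaw_unitNoise (L := L) hW x
  rw [h.map_eq_gaussianReal, integral_unitNoise hW x,
    variance_of_integral_eq_zero h.aemeasurable (integral_unitNoise hW x)]
  have := integral_unitNoise_mul_same hW x x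
  rw [if_pos rfl] at this
  simp only [sq, this, Real.toNNReal_one]

omit hL in
theorem memLp_unitNoise_sq (hW : IsWhiteNoise P W) {n : ℕ} (x : UnitLat L n) :
    MemLp (fun ω => unitNoise L W n x ω ^ 2) 2 P := by
  have h := (hasGaussianLaw_unitNoise (L := L) hW x)
  rw [memLp_two_iff_integrable_sq (h.aemeasurable.pow_const 2).aestronglyMeasurable]
  have := (h.memLp (p := 4) (by norm_num)).integrable_norm_pow (by norm_num)
  refine this.congr (Eventually.of_forall fun ω => ?_)
  simp only [Real.norm_eq_abs]
  rw [← pow_mul]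
  exact Even.pow_abs (by decide) _

theorem variance_unitNoise_sq (hW : IsWhiteNoise P W) {n : ℕ} (x : UnitLat L n) :
    Var[fun ω => unitNoise L W n x ω ^ 2; P] = sqVar := by
  have h := hasGaussianLaw_unitNoise (L := L) hW x
  rw [sqVar, ← map_unitNoise hW x, variance_map (by fun_prop) h.aemeasurable]
  rfl

theorem indepFun_unitNoise_sq (hW : IsWhiteNoise P W) {n : ℕ} {x y : UnitLat L n} (h : x ≠ y) :
    IndepFun (fun ω => unitNoise L W n x ω ^ 2) (fun ω => unitNoise L W n y ω ^ 2) P := by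
  have hprob := hW.gaussian.isProbabilityMeasure
  have h1 : HasGaussianLaw (fun ω => (unitNoise L W n x ω, unitNoise L W n y ω)) P := by
    have := (hW.gaussian.smul fun _ => ((L : ℝ) ^ n)⁻¹ * (L : ℝ) ^ (2 * n)).hasGaussianLaw_prodMk
      (s := indicatorConstLp 2 (measurableSet_cell L n x) (measure_ne_top torusMeasure _) (1 : ℝ))
      (t := indicatorConstLp 2 (measurableSet_cell L n y) (measure_ne_top torusMeasure _) (1 : ℝ))
    refine this.congr (Eventually.of_forall fun ω => ?_)
    simp [unitNoise, torusNoise, mul_assoc]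
  have h2 : cov[unitNoise L W n x, unitNoise L W n y; P] = 0 := by
    rw [covariance_eq_sub (memLp_unitNoise hW x) (memLp_unitNoise hW y), integral_unitNoise hW x,
      zero_mul, sub_zero]
    simpa [h.symm] using integral_unitNoise_mul_same hW x y
  exact (h1.indepFun_of_covariance_eq_zero h2).comp (φ := fun t : ℝ => t ^ 2)
    (ψ := fun t : ℝ => t ^ 2) (by fun_prop) (by fun_prop)

/-- The average over `L ^ (2 * k)` cells has variance `L ^ (-2 * k)` times that of one term, by
pairwise independence. -/
theorem integral_sqAvg_sub_one_sq (hW : IsWhiteNoise P W) (n k : ℕ) (x : UnitLat L n) :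
    MemLp (fun ω => sqAvg (fun m y => unitNoise L W m y ω) (n + k) n x - 1) 2 P ∧
    ∫ ω, (sqAvg (fun m y => unitNoise L W m y ω) (n + k) n x - 1) ^ 2 ∂P
      = sqVar * ((L : ℝ) ^ (2 * k))⁻¹ := by
  have hp := side_pos L
  have hprob := hW.gaussian.isProbabilityMeasure
  have hk : n ≤ n + k := Nat.le_add_right n k
  set s := Finset.univ.filter fun y : UnitLat L (n + k) => parent hk y = x with hs
  have hcard : (s.card : ℝ) = (L : ℝ) ^ (2 * k) := by
    rw [hs, card_block, Nat.add_sub_cancel_left]; push_cast; rfl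
  have e : ∀ ω, sqAvg (fun m y => unitNoise L W m y ω) (n + k) n x
      = ((L : ℝ) ^ (2 * k))⁻¹ * ∑ y ∈ s, unitNoise L W (n + k) y ω ^ 2 := by
    intro ω
    rw [sqAvg, coarse_eq hk, Nat.add_sub_cancel_left]
    simp only [Pi.mul_apply, sq, hs]
  have hsum : MemLp (fun ω => ∑ y ∈ s, unitNoise L W (n + k) y ω ^ 2) 2 P :=
    memLp_finsetSum _ fun y _ => memLp_unitNoise_sq hW y
  have hmean : ∫ ω, ((L : ℝ) ^ (2 * k))⁻¹ * ∑ y ∈ s, unitNoise L W (n + k) y ω ^ 2 ∂P = 1 := by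
    rw [integral_const_mul, integral_finsetSum _ fun y _ =>
      (memLp_unitNoise_sq hW y).integrable one_le_two]
    have : ∀ y : UnitLat L (n + k), ∫ ω, unitNoise L W (n + k) y ω ^ 2 ∂P = 1 := by
      intro y
      have := integral_unitNoise_mul_same hW y y
      rw [if_pos rfl] at this
      simpa only [sq] using this
    simp only [this, Finset.sum_const, nsmul_eq_mul, hcard, mul_one]
    exact inv_mul_cancel₀ (by positivity)
  simp only [e]
  have hmem := (hsum.const_mul ((L : ℝ) ^ (2 * k))⁻¹)
  refine ⟨hmem.sub (memLp_const 1), ?_⟩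
  have h1 := variance_eq_integral hmem.aestronglyMeasurable.aemeasurable
  rw [hmean] at h1
  rw [← h1, variance_const_mul]
  have h2 := IndepFun.variance_sum (μ := P) (s := s)
    (X := fun y ω => unitNoise L W (n + k) y ω ^ 2) (fun y _ => memLp_unitNoise_sq hW y)
    (fun y _ z _ hyz => indepFun_unitNoise_sq hW hyz)
  have h3 : (∑ y ∈ s, fun ω => unitNoise L W (n + k) y ω ^ 2)
      = fun ω => ∑ y ∈ s, unitNoise L W (n + k) y ω ^ 2 := by
    ext ω; simp
  rw [h3] at h2
  rw [h2]
  simp only [variance_unitNoise_sq hW, Finset.sum_const, nsmul_eq_mul, hcard]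
  field_simp

/-- The averages of the squared noise over larger and larger numbers of cells converge fast enough
to their expectation to be almost surely summable. -/
theorem ae_summable_sqAvg_sub_one (hW : IsWhiteNoise P W) (hL1 : 1 < L) (n : ℕ) (x : UnitLat L n) :
    ∀ᵐ ω ∂P, Summable fun k => sqAvg (fun m y => unitNoise L W m y ω) (n + k) n x - 1 := by
  have hp := side_pos L
  have h1 := fun k => integral_sqAvg_sub_one_sq (P := P) (L := L) hW n k x
  have hnorm : ∀ k, eLpNorm (fun ω => sqAvg (fun m y => unitNoise L W m y ω) (n + k) n x - 1) 2 P
      = ENNReal.ofReal (Real.sqrt sqVar * (L : ℝ)⁻¹ ^ k) := by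
    intro k
    rw [(h1 k).1.eLpNorm_eq_integral_rpow_norm (by norm_num) (by norm_num)]
    congr 1
    have e : ∀ ω, ‖sqAvg (fun m y => unitNoise L W m y ω) (n + k) n x - 1‖ ^ (2 : ℝ≥0∞).toReal
        = (sqAvg (fun m y => unitNoise L W m y ω) (n + k) n x - 1) ^ 2 := by
      intro ω
      simp
    simp only [e, (h1 k).2]
    rw [ENNReal.toReal_ofNat, inv_eq_one_div (2 : ℝ), ← Real.sqrt_eq_rpow,
      Real.sqrt_mul (show 0 ≤ sqVar from variance_nonneg _ _)]
    congr 1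
    rw [Real.sqrt_eq_iff_mul_self_eq (by positivity) (by positivity)]
    rw [inv_pow, ← mul_inv, ← pow_add, two_mul]
  have hsum : Summable fun k => Real.sqrt sqVar * (L : ℝ)⁻¹ ^ k := by
    refine (summable_geometric_of_lt_one (by positivity) ?_).mul_left _
    exact inv_lt_one_of_one_lt₀ (by exact_mod_cast hL1)
  have h2 := summable_norm_of_tsum_eLpNorm_ne_top (μ := P) one_le_two
    (fun k => (h1 k).1.aestronglyMeasurable) (by
      simp only [hnorm]
      exact hsum.tsum_ofReal_ne_top)
  filter_upwards [h2] with ω hω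
  exact hω.of_norm

theorem ae_tendsto_secondChaos (hW : IsWhiteNoise P W) (hL1 : 1 < L)
    (hξ : ∀ᵐ ω ∂P, ∀ n, (fun x => unitNoise L W n x ω) =
      (L : ℝ) • coarse L (n + 1) n fun y => unitNoise L W (n + 1) y ω) :
    ∀ᵐ ω ∂P, ∃ Ξs : Traj L, ∀ n,
      Tendsto (fun N => fun x => secondChaos P L W N n x ω) atTop (𝓝 (Ξs n)) := by
  have h1 : ∀ᵐ ω ∂P, ∀ n (x : UnitLat L n),
      Summable fun k => sqAvg (fun m y => unitNoise L W m y ω) (n + k) n x - 1 :=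
    ae_all_iff.2 fun n => ae_all_iff.2 fun x => ae_summable_sqAvg_sub_one hW hL1 n x
  filter_upwards [hξ, h1] with ω hω hsum
  let f : (n : ℕ) → UnitLat L n → ℕ → ℝ := fun n x k =>
    (sqAvg (fun m y => unitNoise L W m y ω) (n + (k + 1)) n x - 1)
      - ((L : ℝ) ^ 2)⁻¹ * (sqAvg (fun m y => unitNoise L W m y ω) (n + k) n x - 1)
  have hf : ∀ n x, Summable (f n x) := fun n x =>
    ((summable_nat_add_iff 1).2 (hsum n x)).sub ((hsum n x).mul_left _)
  refine ⟨fun n x => ∑' k, f n x k, fun n => tendsto_pi_nhds.2 fun x => ?_⟩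
  refine Tendsto.congr' ((eventually_ge_atTop n).mono fun N hn => ?_)
    ((hf n x).hasSum.tendsto_sum_nat.comp (tendsto_sub_atTop_nat n))
  have := congrFun (secondChaos_eq hW hω hn) x
  dsimp only [Function.comp_apply]
  rw [this, Finset.sum_Ico_eq_sum_range, Finset.sum_apply]
  rfl

end Chaos

/-! ### Smallness on the good event -/

section GoodEvent

variable {L : ℕ} [hL : Fact (Odd L)] {Ω : Type*} [MeasurableSpace Ω] {P : Measure Ω}
  {W : Lp ℝ 2 torusMeasure → Ω → ℝ} {κ g : ℝ} {ω : Ω}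

theorem le_of_mem_goodEvent (hg : 0 < g) (h : ω ∈ goodEvent P L κ W g) {N n : ℕ} (hn : n ≤ N)
    (x : UnitLat L n) :
    |unitNoise L W n x ω| ≤ (2 * g)⁻¹ * (L : ℝ) ^ (κ * n) ∧
      √|secondChaos P L W N n x ω| ≤ (2 * g)⁻¹ * (L : ℝ) ^ (κ * n) := by
  have hp := side_pos L
  have h1 : ENNReal.ofReal ((L : ℝ) ^ (-κ * n)) *
      max (⨆ x : UnitLat L n, ENNReal.ofReal |truncNoise L W N n x ω|)
        (⨆ x : UnitLat L n, ENNReal.ofReal (Real.sqrt |secondChaos P L W N n x ω|))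
      ≤ ENNReal.ofReal (2 * g)⁻¹ :=
    (le_iSup₂_of_le (f := fun N n : ℕ => ENNReal.ofReal ((L : ℝ) ^ (-κ * n)) *
      max (⨆ x : UnitLat L n, ENNReal.ofReal |truncNoise L W N n x ω|)
        (⨆ x : UnitLat L n, ENNReal.ofReal (Real.sqrt |secondChaos P L W N n x ω|)))
      N n le_rfl).trans h
  have key : ∀ t : ℝ, ENNReal.ofReal t ≤
      max (⨆ x : UnitLat L n, ENNReal.ofReal |truncNoise L W N n x ω|)
        (⨆ x : UnitLat L n, ENNReal.ofReal (Real.sqrt |secondChaos P L W N n x ω|)) →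
      t ≤ (2 * g)⁻¹ * (L : ℝ) ^ (κ * n) := by
    intro t ht
    have h2 := (mul_le_mul_right ht (ENNReal.ofReal ((L : ℝ) ^ (-κ * n)))).trans h1
    rw [← ENNReal.ofReal_mul (by positivity), ENNReal.ofReal_le_ofReal_iff (by positivity),
      neg_mul, Real.rpow_neg hp.le, inv_mul_le_iff₀ (by positivity)] at h2
    linarith
  constructor
  · refine key _ (le_max_of_le_left ?_)
    have := le_iSup (fun x : UnitLat L n => ENNReal.ofReal |truncNoise L W N n x ω|) x
    simpa only [truncNoise, if_pos hn] using this
  · exact key _ (le_max_of_le_right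
      (le_iSup (fun x : UnitLat L n => ENNReal.ofReal (√|secondChaos P L W N n x ω|)) x))

/-- With `s = L ^ (-5/6)`, which is the size of `λ_{-1} ξ_{-1}` for `κ = 1/6`, one has
`L² s³ = L ^ (-1/2)`. -/
theorem isSmall_of_mem_goodEvent {r : ℝ} (hr : 1 ≤ r) (hL1 : 2304 ≤ L) (hL2 : 4 * (r + 1) ≤ L)
    (hκ : κ ≤ 1 / 6) (hg : 0 < g) (hg1 : g ≤ 1) (h : ω ∈ goodEvent P L κ W g) :
    IsSmall r g ((L : ℝ) ^ (-(5 / 6) : ℝ)) (fun n x => unitNoise L W n x ω)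
      (fun N n x => secondChaos P L W N n x ω) := by
  have hp := side_pos L
  have hL1' : (2304 : ℝ) ≤ L := by exact_mod_cast hL1
  have hone : (1 : ℝ) ≤ L := by linarith
  have hs : 0 < (L : ℝ) ^ (-(5 / 6) : ℝ) := Real.rpow_pos_of_pos hp _
  -- The lower bound on `L` is `48²`.
  have hhalf : (L : ℝ) ^ (-(1 / 2) : ℝ) ≤ 1 / 48 := by
    rw [Real.rpow_neg hp.le, ← Real.sqrt_eq_rpow, one_div]
    refine inv_anti₀ (by norm_num) (Real.le_sqrt_of_sq_le ?_)
    norm_num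
    exact hL1
  have hbound : ∀ n : ℕ, lamC L g n * ((2 * g)⁻¹ * (L : ℝ) ^ (κ * n))
      ≤ ((L : ℝ) ^ (-(5 / 6) : ℝ)) ^ n / 2 := by
    intro n
    have e1 : ((L : ℝ) ^ (-(5 / 6) : ℝ)) ^ n = ((L : ℝ) ^ n)⁻¹ * (L : ℝ) ^ ((1 / 6 : ℝ) * n) := by
      rw [← Real.rpow_natCast, ← Real.rpow_mul hp.le, ← Real.rpow_natCast, ← Real.rpow_neg hp.le,
        ← Real.rpow_add hp]
      congr 1
      ring
    have e2 : lamC L g n * ((2 * g)⁻¹ * (L : ℝ) ^ (κ * n))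
        = ((L : ℝ) ^ n)⁻¹ * (L : ℝ) ^ (κ * n) / 2 := by
      rw [lamC]; field_simp
    rw [e1, e2]
    gcongr
  have hlam : ∀ n, 0 ≤ lamC L g n := fun n => by unfold lamC; positivity
  refine ⟨hs, ?_, ?_, fun n => ?_, fun N n hn => ?_, fun n => ?_, hr⟩
  · refine (Real.rpow_le_rpow_of_exponent_le hone (by norm_num)).trans (hhalf.trans (by norm_num))
  · rw [← Real.rpow_natCast (_ ^ _), ← Real.rpow_mul hp.le, ← Real.rpow_natCast (L : ℝ),
      ← Real.rpow_add hp]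
    norm_num at hhalf ⊢
    exact hhalf
  · refine (pi_norm_le_iff_of_nonneg (by positivity)).2 fun x => ?_
    rw [Pi.smul_apply, smul_eq_mul, Real.norm_eq_abs, abs_mul, abs_of_nonneg (hlam n)]
    exact (mul_le_mul_of_nonneg_left (le_of_mem_goodEvent hg h le_rfl x).1 (hlam n)).trans
      (hbound n)
  · refine (pi_norm_le_iff_of_nonneg (by positivity)).2 fun x => ?_
    rw [Pi.smul_apply, smul_eq_mul, Real.norm_eq_abs, abs_mul, abs_of_nonneg (sq_nonneg _)]
    have h1 := (mul_le_mul_of_nonneg_left (le_of_mem_goodEvent hg h hn x).2 (hlam n)).trans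
      (hbound n)
    have h2 := pow_le_pow_left₀ (mul_nonneg (hlam n) (Real.sqrt_nonneg _)) h1 2
    rw [mul_pow, Real.sq_sqrt (abs_nonneg _)] at h2
    linarith
  · have e1 : ((L : ℝ) ^ (n + 1))⁻¹ ≤ ((L : ℝ) ^ (-(5 / 6) : ℝ)) ^ (n + 1) := by
      rw [← inv_pow, ← Real.rpow_neg_one]
      gcongr
      norm_num
    -- The linear growth of `μ L^(2n)` in `n` costs only a factor `L ^ n`.
    have e2 : 4 * (r + (n + 1 : ℕ)) ≤ (L : ℝ) ^ (n + 1) := by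
      have h1 : ((n + 1 : ℕ) : ℝ) ≤ 2 ^ n := by
        exact_mod_cast Nat.succ_le_of_lt (Nat.lt_two_pow_self)
      have h2 : (2 : ℝ) ^ n ≤ (L : ℝ) ^ n := pow_le_pow_left₀ (by norm_num) (by linarith) n
      have h3 : (1 : ℝ) ≤ (n + 1 : ℕ) := by push_cast; linarith [Nat.cast_nonneg (α := ℝ) n]
      calc 4 * (r + (n + 1 : ℕ)) ≤ 4 * (r + 1) * (n + 1 : ℕ) := by nlinarith
        _ ≤ L * (L : ℝ) ^ n := mul_le_mul hL2 (h1.trans h2) (by positivity) hp.le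
        _ = _ := (pow_succ' _ _).symm
    have hL0 : 0 ≤ ((L : ℝ) ^ 2)⁻¹ := by positivity
    have hLi : ((L : ℝ) ^ 2)⁻¹ ≤ 1 := inv_le_one_of_one_le₀ (one_le_pow₀ hone)
    have hc : (1 - ((L : ℝ) ^ 2)⁻¹) * g ^ 2 ≤ 1 :=
      mul_le_one₀ (by linarith) (sq_nonneg g) (pow_le_one₀ hg.le hg1)
    have hc0 : 0 ≤ (1 - ((L : ℝ) ^ 2)⁻¹) * g ^ 2 := mul_nonneg (by linarith) (sq_nonneg g)
    have hn0 : (0 : ℝ) ≤ (n + 1 : ℕ) := Nat.cast_nonneg _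
    have e3 : |r - (n + 1 : ℕ) * (1 - ((L : ℝ) ^ 2)⁻¹) * g ^ 2| ≤ r + (n + 1 : ℕ) := by
      rw [mul_assoc]
      refine abs_le.2 ⟨?_, ?_⟩ <;> nlinarith
    rw [muC, abs_mul, abs_of_pos (by positivity)]
    calc _ ≤ ((L : ℝ) ^ (2 * (n + 1)))⁻¹ * ((L : ℝ) ^ (n + 1) / 4) := by
          gcongr
          linarith
      _ = ((L : ℝ) ^ (n + 1))⁻¹ / 4 := by
          rw [two_mul (n + 1), pow_add]; field_simp
      _ ≤ _ := by gcongr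

omit hL in
/-- The remainder flow on the lattices `Λ^n`, `n ≤ N`, does not see the noise at finer scales. -/
theorem isRemainderFlow_congr {r : ℝ} {N : ℕ} {ξ ξ' Ξ Ψ R : Traj L} (h : ∀ n ≤ N, ξ n = ξ' n) :
    IsRemainderFlow L r g N ξ Ξ Ψ R ↔ IsRemainderFlow L r g N ξ' Ξ Ψ R := by
  have key : ∀ {ξ ξ' : Traj L}, (∀ n ≤ N, ξ n = ξ' n) → IsRemainderFlow L r g N ξ Ξ Ψ R →
      IsRemainderFlow L r g N ξ' Ξ Ψ R := fun {ξ ξ'} h hR =>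
    { psi_zero := hR.psi_zero
      rem_zero := hR.rem_zero
      rem_eq := fun n h1 hn => by
        have := hR.rem_eq n h1 hn
        rwa [h n hn] at this
      psi_eq := fun n hn => by
        have := hR.psi_eq n hn
        rwa [h (n + 1) hn] at this }
  exact ⟨key h, key fun n hn => (h n hn).symm⟩

end GoodEvent

end

theorem proposition3p3 :
    ∃ κ₀ : ℝ, 0 < κ₀ ∧ ∀ r : ℝ, 1 ≤ r →
    ∃ L₀ : ℕ, ∀ L : ℕ, Odd L → L₀ ≤ L →
    ∀ κ : ℝ, 0 < κ → κ ≤ κ₀ →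
    ∀ (Ω : Type*) [MeasurableSpace Ω] (P : Measure Ω) [IsProbabilityMeasure P]
      (W : Lp ℝ 2 torusMeasure → Ω → ℝ), IsWhiteNoise P W →
    ∀ g : ℝ, 0 < g → g ≤ 1 →
    ∀ᵐ ω ∂P, ω ∈ goodEvent P L κ W g →
      ∃ (u : (N : ℕ) → UnitLat L N → ℝ) (Ψ R : ℕ → Traj L),
        (∀ (N : ℕ) (u' : UnitLat L N → ℝ),
          IsBareSolution L r g N (fun z => torusNoise L W N z ω) u' ↔ u' = u N) ∧
        (∀ (N : ℕ) (Ψ' R' : Traj L),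
          IsRemainderFlow L r g N (fun n x => truncNoise L W N n x ω)
            (fun n x => secondChaos P L W N n x ω) Ψ' R' ↔ Ψ' = Ψ N ∧ R' = R N) ∧
        ∃ vs Ξs Ψs : Traj L, ∀ n : ℕ,
          Tendsto (fun N => coarseSol L N n (u N)) atTop (𝓝 (vs n)) ∧
          Tendsto (fun N => fun x => secondChaos P L W N n x ω) atTop (𝓝 (Ξs n)) ∧
          Tendsto (fun N => Ψ N n) atTop (𝓝 (Ψs n)) ∧
          (∀ x : UnitLat L n,
            negLap L n (vs n) x =
              (lamC L g n * unitNoise L W n x ω + lamC L g n ^ 2 * Ξs n x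
                + lamC L g n ^ 3 * Ψs n x + muC L r g n) * vs n x + gamC L n) ∧
          ∀ m : ℕ, n < m → ∀ x : UnitLat L n,
            vs n x = ((L : ℝ) ^ (m - n))⁻¹ * coarse L m n (vs m) x := by
  refine ⟨1 / 6, by norm_num, fun r hr => ⟨max 2304 ⌈4 * (r + 1)⌉₊, ?_⟩⟩
  intro L hodd hL κ _ hκ Ω _ P _ W hW g hg hg1
  have : Fact (Odd L) := ⟨hodd⟩
  have hp := side_pos L
  have hL1 : 2304 ≤ L := (le_max_left _ _).trans hL
  have hL2 : 4 * (r + 1) ≤ L := Nat.ceil_le.1 ((le_max_right _ _).trans hL)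
  have hξ : ∀ᵐ ω ∂P, ∀ n, (fun x => unitNoise L W n x ω) =
      (L : ℝ) • coarse L (n + 1) n fun y => unitNoise L W (n + 1) y ω := by
    have : ∀ᵐ ω ∂P, ∀ n (x : UnitLat L n), unitNoise L W n x ω =
        L * coarse L (n + 1) n (fun y => unitNoise L W (n + 1) y ω) x :=
      ae_all_iff.2 fun n => ae_all_iff.2 fun x => unitNoise_ae_eq hW n x
    filter_upwards [this] with ω hω n
    exact funext (hω n)
  filter_upwards [hξ, ae_tendsto_secondChaos hW (by omega) hξ] with ω hω ⟨Ξs, hΞs⟩ hgood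
  have hN := isEnhancedNoise_unitNoise hW hω
  obtain ⟨u, Ψ, R, hu, hR, vs, Ψs, hlim⟩ :=
    (isSmall_of_mem_goodEvent hr hL1 hL2 hκ hg hg1 hgood).exists_solution_and_limits hN
      hg.ne' hΞs
  refine ⟨u, Ψ, R, fun N u' => ?_, fun N Ψ' R' => ?_, vs, Ξs, Ψs, fun n => ?_⟩
  · rw [← hu N u']
    have : (fun z => torusNoise L W N z ω) = (L : ℝ) ^ N • fun x => unitNoise L W N x ω := by
      ext z
      simp only [Pi.smul_apply, smul_eq_mul, unitNoise]
      field_simp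
    rw [this]
  · rw [← hR N Ψ' R']
    exact isRemainderFlow_congr fun n hn => by
      ext x
      simp only [truncNoise, if_pos hn]
  · obtain ⟨h1, h2, h3, h4⟩ := hlim n
    exact ⟨h1, hΞs n, h2, h3, h4⟩
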